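/- **Setting.** Let $\mathcal A$ be a finite nonempty action set and let $\mathcal Y$ be a Euclidean space or a compact subset of one. The true data generating process gives for each $a\in\mathcal A$ a probability measure $Q^*(\cdot\mid a)$ on $\mathcal Y$ with positive density $q^*(\cdot\mid a)$ with respect to a common measure $\nu$; the flow payoff is $u(a,y)\in\mathbb R$ with $u(a,\cdot)\in L^1(Q^*(\cdot\mid a))$. Let $\delta\in[0,1)$ be the discount factor and $\alpha>1$ the switching threshold. A *model* $\theta$ consists of a nonempty finite subset $\Omega^\theta$ of a Euclidean space and, for all $a\in\mathcal A$, $\omega\in\Omega^\theta$, a probability measure $Q^\theta(\cdot\mid a,\omega)$ on $\mathcal Y$ with positive $\nu$-density $q^\theta(\cdot\mid a,\omega)$, such that $u(a,\cdot)\in L^1(Q^\theta(\cdot\mid a,\omega))$ and there is $g_a\in L^2(\nu)$ with $|\ln (q^*(\cdot\mid a)/q^\theta(\cdot\mid a,\omega))|\le g_a$ $Q^*(\cdot\mid a)$-a.s. Let $\Theta$ be the set of all models. For a belief $\pi\in\Delta\Omega^\theta$ let $B^\theta(a,y,\pi)$ be its Bayesian update. Let $U^\theta$ be the (bounded measurable)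 solution of $$U^\theta(\pi)=\max_{a\in\mathcal A}\sum_{\omega\in\Omega^\theta}\pi(\omega)\int_{\mathcal Y}\big[u(a,y)+\delta U^\theta(B^\theta(a,y,\pi))\big]q^\theta(y\mid a,\omega)\,\nu(dy).$$ A (measurable) policy $a^\theta:\Delta\Omega^\theta\to\mathcal A$ is *optimal* if $a^\theta(\pi)$ attains this maximum for every $\pi\in\Delta\Omega^\theta$. **Switching and persistence.** A switcher has an initial model $\theta$ and a competing model $\theta^c$, with full-support priors $\pi_0^\theta,\pi_0^{\theta^c}$ and optimal policies $a^\theta,a^{\theta^c}$. The model choice starts at $m_0=\theta$. In each period $t\ge 1$ she computes $l_t^{\theta'}=\sum_{\omega}\pi_0^{\theta'}(\omega)\prod_{\tau<t}q^{\theta'}(y_\tau\mid a_\tau,\omega)$ for both models; if the ratio of the likelihood of the model other than $m_{t-1}$ to that of $m_{t-1}$ exceeds $\alpha$, she switches to the other model, and otherwise $m_t=m_{t-1}$. In each period $t\ge0$ she plays $a_t=a^{m_t}(\pi_t^{m_t})$, where $\pi_t^{m_t}$ is the posterior of $m_t$ given the whole history, and observes $y_t$, where the outcomes of each action in each period are independent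 draws from $Q^*$. The model $\theta$ *persists against* $\theta^c$ (at the given priors and policies) if with positive probability $m_t$ converges to $\theta$. **Global robustness.** $\theta\in\Theta$ is *globally robust* if there exist a full-support $\pi_0^\theta$ and an optimal $a^\theta$ under which $\theta$ persists against every $\theta^c\in\Theta$ at every full-support $\pi_0^{\theta^c}$ and optimal $a^{\theta^c}$. **Unconstrained local robustness.** For $Q,Q'\in(\Delta\mathcal Y)^{\mathcal A}$ let $d(Q,Q')=\max_{a}d_P(Q_a,Q'_a)$, with $d_P$ the Prokhorov distance. Let $Q^{\theta,\omega}=(Q^\theta(\cdot\mid a,\omega))_{a\in\mathcal A}$, let $\mathcal Q^\theta=\{Q^{\theta,\omega}:\omega\in\Omega^\theta\}$, and let $N_\epsilon(\theta)$ be the set of $\theta'\in\Theta$ for which the Hausdorff distance (induced by $d$) between $\mathcal Q^\theta$ and $\mathcal Q^{\theta'}$ is at most $\epsilon$. For $\pi\in\Delta\Omega^\theta$ let $\Gamma^\theta(\pi)=\sum_{\omega}\pi(\omega)\,\delta_{Q^{\theta,\omega}}$, a belief over $(\Delta\mathcal Y)^{\mathcal A}$, and let $D_\epsilon(\pi;\theta^c)$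 be the set of $\pi^c\in\Delta\Omega^{\theta^c}$ with $d_P(\Gamma^\theta(\pi),\Gamma^{\theta^c}(\pi^c))\le\epsilon$, where this Prokhorov distance is taken over the metric space $((\Delta\mathcal Y)^{\mathcal A},d)$. Then $\theta\in\Theta$ is *unconstrained locally robust* if there exist $\epsilon>0$, a full-support $\pi_0^\theta$ and an optimal $a^\theta$ under which $\theta$ persists against every $\theta^c\in N_\epsilon(\theta)$ at every full-support $\pi_0^{\theta^c}\in D_\epsilon(\pi_0^\theta;\theta^c)$ and optimal $a^{\theta^c}$. **Theorem.** A model $\theta\in\Theta$ is unconstrained locally robust if and only if it is globally robust. -/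

import Mathlib

open MeasureTheory Filter
open scoped ENNReal

noncomputable section

namespace ModelSwitching

variable {A Y : Type*} [MeasurableSpace Y]

/-! ### Objective environment and subjective models -/

/-- The objective environment: a reference measure `ν` on the outcome space, the positive
`ν`-densities `q a` of the true outcome distributions `Q*(· | a)`, and the flow payoff `u a y`,
integrable under the true distribution. -/
structure Environment (A Y : Type*) [MeasurableSpace Y] where
  /-- the common dominating measure -/
  ν : Measure Y
  /-- the true density `q*(y | a)` -/
  q : A → Y → ℝ
  /-- the flow payoff `u(a, y)` -/
  u : A → Y → ℝ
  measurable_q : ∀ a, Measurable (q a)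
  q_pos : ∀ a y, 0 < q a y
  lintegral_q : ∀ a, ∫⁻ y, ENNReal.ofReal (q a y) ∂ν = 1
  integrable_u : ∀ a, Integrable (u a) (ν.withDensity fun y => ENNReal.ofReal (q a y))

/-- The true outcome distribution `Q*(· | a)`. -/
def Environment.law (E : Environment A Y) (a : A) : Measure Y :=
  E.ν.withDensity fun y => ENNReal.ofReal (E.q a y)

instance (E : Environment A Y) (a : A) : IsProbabilityMeasure (E.law a) :=
  ⟨by rw [Environment.law, withDensity_apply _ MeasurableSet.univ, Measure.restrict_univ,
    E.lintegral_q a]⟩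

/-- A subjective model: a nonempty finite parameter set in some Euclidean space, and for every
action and parameter a positive outcome density with respect to `ν`, subject to integrability of
the payoff and to a square-integrable bound on the log-likelihood ratio with the truth.
The type `Model E` is the set of all admissible models. -/
structure Model (E : Environment A Y) where
  /-- dimension of the Euclidean space containing the parameters -/
  dim : ℕ
  /-- the parameter set `Ω` -/
  params : Finset (EuclideanSpace ℝ (Fin dim))
  nonempty : params.Nonempty
  /-- the predicted density `q(y | a, ω)` -/
  q : A → params → Y → ℝ
  measurable_q : ∀ a ω, Measurable (q a ω)
  q_pos : ∀ a ω y, 0 < q a ω y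
  lintegral_q : ∀ a ω, ∫⁻ y, ENNReal.ofReal (q a ω y) ∂E.ν = 1
  integrable_u : ∀ a ω, Integrable (E.u a) (E.ν.withDensity fun y => ENNReal.ofReal (q a ω y))
  log_dominated : ∀ a ω, ∃ g : Y → ℝ, MemLp g 2 E.ν ∧
    ∀ᵐ y ∂E.law a, |Real.log (E.q a y / q a ω y)| ≤ g y

variable {E : Environment A Y}

namespace Model

/-- Beliefs (and priors) over the parameters of a model: the simplex `ΔΩ`. -/
abbrev Belief (θ : Model E) : Type := stdSimplex ℝ θ.params

/-- The predicted outcome distribution `Q(· | a, ω)`, as a measure. -/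
def lawMeasure (θ : Model E) (a : A) (ω : θ.params) : Measure Y :=
  E.ν.withDensity fun y => ENNReal.ofReal (θ.q a ω y)

/-- The predicted outcome distribution `Q(· | a, ω)`. -/
def law (θ : Model E) (a : A) (ω : θ.params) : ProbabilityMeasure Y :=
  ⟨θ.lawMeasure a ω,
    ⟨by rw [lawMeasure, withDensity_apply _ MeasurableSet.univ, Measure.restrict_univ,
      θ.lintegral_q a ω]⟩⟩

/-- A belief has full support if it gives every parameter positive weight. -/
def FullSupport (θ : Model E) (π : θ.Belief) : Prop := ∀ ω, 0 < π.1 ω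

/-! ### Bayesian learning and optimal policies -/

/-- Density of outcome `y` after action `a` that is predicted at belief `π`. -/
def predictive (θ : Model E) (π : θ.Belief) (a : A) (y : Y) : ℝ := ∑ ω, π.1 ω * θ.q a ω y

theorem predictive_pos (θ : Model E) (π : θ.Belief) (a : A) (y : Y) :
    0 < θ.predictive π a y := by
  have h0 : ∀ ω, 0 ≤ π.1 ω := π.2.1
  have h1 : ∑ ω, π.1 ω = 1 := π.2.2
  refine lt_of_le_of_ne (Finset.sum_nonneg fun ω _ => mul_nonneg (h0 ω) (θ.q_pos a ω y).le) ?_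
  intro h
  have hz := (Finset.sum_eq_zero_iff_of_nonneg
    (fun ω _ => mul_nonneg (h0 ω) (θ.q_pos a ω y).le)).1 h.symm
  have hz' : ∀ ω, π.1 ω = 0 := fun ω =>
    (mul_eq_zero.1 (hz ω (Finset.mem_univ ω))).resolve_right (θ.q_pos a ω y).ne'
  simp [hz'] at h1

/-- The Bayesian operator `B(a, y, π)`. -/
def bayes (θ : Model E) (a : A) (y : Y) (π : θ.Belief) : θ.Belief :=
  ⟨fun ω => π.1 ω * θ.q a ω y / θ.predictive π a y,
    fun ω => div_nonneg (mul_nonneg (π.2.1 ω) (θ.q_pos a ω y).le) (θ.predictive_pos π a y).le,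
    by rw [← Finset.sum_div]; exact div_self (θ.predictive_pos π a y).ne'⟩

/-- Expected discounted payoff of playing `a` at belief `π` with continuation value `U`. -/
def actionValue (θ : Model E) (δ : ℝ) (U : θ.Belief → ℝ) (a : A) (π : θ.Belief) : ℝ :=
  ∑ ω, π.1 ω * ∫ y, (E.u a y + δ * U (θ.bayes a y π)) * θ.q a ω y ∂E.ν

/-- `U` is the value function of the dynamic programming problem: the (unique) bounded measurable
solution of the Bellman equation. -/
structure IsValueFunction (θ : Model E) (δ : ℝ) (U : θ.Belief → ℝ) : Prop where
  measurable : Measurable U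
  bounded : ∃ C, ∀ π, |U π| ≤ C
  bellman : ∀ π, IsGreatest (Set.range fun a => θ.actionValue δ U a π) (U π)

/-- A pure optimal policy: a measurable map from beliefs to actions that solves the dynamic
programming problem at every belief. -/
structure IsOptimalPolicy (θ : Model E) (δ : ℝ) (p : θ.Belief → A) : Prop where
  measurable : ∀ a, MeasurableSet (p ⁻¹' {a})
  optimal : ∃ U, θ.IsValueFunction δ U ∧ ∀ π, θ.actionValue δ U (p π) π = U π

/-- The likelihood `l_t` of a finite history under the prior `π`. -/
def likelihood (θ : Model E) (π : θ.Belief) (h : List (A × Y)) : ℝ :=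
  ∑ ω, π.1 ω * (h.map fun x => θ.q x.1 ω x.2).prod

/-- The posterior belief `π_t` after a finite history (most recent period first). -/
def posterior (θ : Model E) (π : θ.Belief) : List (A × Y) → θ.Belief
  | [] => π
  | x :: h => θ.bayes x.1 x.2 (posterior θ π h)

end Model

/-! ### The switcher -/

/-- A model together with a prior and a policy. -/
structure Endowed (E : Environment A Y) where
  /-- the model -/
  model : Model E
  /-- the prior over its parameters -/
  prior : model.Belief
  /-- the policy used while the model is adopted -/
  policy : model.Belief → A

/-- The likelihood `l_t` of a finite history, evaluated at the prior. -/
def Endowed.likelihood (e : Endowed E) (h : List (A × Y)) : ℝ := e.model.likelihood e.prior h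

/-- The action prescribed by the policy at the posterior after a finite history. -/
def Endowed.act (e : Endowed E) (h : List (A × Y)) : A := e.policy (e.model.posterior e.prior h)

/-- The two models entertained by the switcher: the initial one and the competing one. -/
inductive Role
  | initial
  | competing

/-- The other one of the two models. -/
def Role.other : Role → Role
  | .initial => .competing
  | .competing => .initial

/-- The switcher with initial model `I` and competing model `C`. -/
def switcher (I C : Endowed E) : Role → Endowed E
  | .initial => I
  | .competing => C

/-- Bayes factor rule: the model choice `m_t` after a finite history (most recent period first).
The agent starts with the initial model, and moves to the alternative exactly when the ratio of
its likelihood to that of last period's choice exceeds `α`. -/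
def modelChoice (α : ℝ) (S : Role → Endowed E) : List (A × Y) → Role
  | [] => .initial
  | x :: h =>
    let m := modelChoice α S h
    if α < (S m.other).likelihood (x :: h) / (S m).likelihood (x :: h) then m.other else m

/-- The action `a_t` taken by the switcher after a finite history. -/
def action (α : ℝ) (S : Role → Endowed E) (h : List (A × Y)) : A :=
  (S (modelChoice α S h)).act h

/-- The switcher's history `h_t` (most recent period first) when `y t a` is the outcome that
action `a` yields in period `t`. -/
def history (α : ℝ) (S : Role → Endowed E) (y : ℕ → A → Y) : ℕ → List (A × Y)
  | 0 => []
  | t + 1 =>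
    let h := history α S y t
    (action α S h, y t (action α S h)) :: h

variable [Fintype A]

/-- The law of the outcomes `(y_{t,a})`: independent draws from the true distributions. -/
def outcomeLaw (E : Environment A Y) : Measure (ℕ → A → Y) :=
  Measure.infinitePi fun _ : ℕ => Measure.pi fun a => E.law a

/-- With threshold `α`, the endowed model `I`, used as initial model, persists against the endowed
model `C`: with positive probability the model choice converges to (is eventually equal to) the
initial model. -/
def Persists (α : ℝ) (I C : Endowed E) : Prop :=
  0 < outcomeLaw E {y | ∀ᶠ t in atTop,
    modelChoice α (switcher I C) (history α (switcher I C) y t) = .initial}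

/-- Global robustness. -/
def GloballyRobust (δ α : ℝ) (θ : Model E) : Prop :=
  ∃ (π : θ.Belief) (p : θ.Belief → A), θ.FullSupport π ∧ θ.IsOptimalPolicy δ p ∧
    ∀ (θ' : Model E) (π' : θ'.Belief) (p' : θ'.Belief → A),
      θ'.FullSupport π' → θ'.IsOptimalPolicy δ p' → Persists α ⟨θ, π, p⟩ ⟨θ', π', p'⟩

/-! ### Distances between models and between priors -/

variable [PseudoMetricSpace Y] [OpensMeasurableSpace Y]

/-- Action-contingent outcome distributions `(ΔY)^A`, with the maximum over the actions of the
Prokhorov distances (the `Pi` distance) as metric. -/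
abbrev Profile (A Y : Type*) [MeasurableSpace Y] [PseudoMetricSpace Y] : Type _ :=
  A → LevyProkhorov (ProbabilityMeasure Y)

instance : MeasurableSpace (Profile A Y) := borel _

instance : BorelSpace (Profile A Y) := ⟨rfl⟩

/-- The action-contingent outcome distribution induced by the parameter `ω`. -/
def Model.profile (θ : Model E) (ω : θ.params) : Profile A Y :=
  fun a => LevyProkhorov.ofMeasure (θ.law a ω)

/-- The `ε`-neighbourhood of a model, in the Hausdorff distance between the sets of
action-contingent outcome distributions. -/
def Model.neighborhood (θ : Model E) (ε : ℝ) : Set (Model E) :=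
  {θ' | Metric.hausdorffDist (Set.range θ.profile) (Set.range θ'.profile) ≤ ε}

/-- The belief over action-contingent outcome distributions that a belief over parameters
induces. -/
def Model.inducedBelief (θ : Model E) (π : θ.Belief) : Measure (Profile A Y) :=
  ∑ ω, ENNReal.ofReal (π.1 ω) • Measure.dirac (θ.profile ω)

/-- Beliefs of the model `θ'` within Prokhorov distance `ε` of the belief `π` of the model `θ`. -/
def Model.nearbyBeliefs (θ : Model E) (π : θ.Belief) (θ' : Model E) (ε : ℝ) : Set θ'.Belief :=
  {π' | levyProkhorovDist (θ.inducedBelief π) (θ'.inducedBelief π') ≤ ε}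

/-- Unconstrained local robustness. -/
def UnconstrainedLocallyRobust (δ α : ℝ) (θ : Model E) : Prop :=
  ∃ ε : ℝ, 0 < ε ∧ ∃ (π : θ.Belief) (p : θ.Belief → A),
    θ.FullSupport π ∧ θ.IsOptimalPolicy δ p ∧
    ∀ θ' ∈ θ.neighborhood ε, ∀ π' ∈ θ.nearbyBeliefs π θ' ε, ∀ p' : θ'.Belief → A,
      θ'.FullSupport π' → θ'.IsOptimalPolicy δ p' → Persists α ⟨θ, π, p⟩ ⟨θ', π', p'⟩

end ModelSwitching

end

namespace ModelSwitching

/-! ### Infinite products of a probability measure -/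

section Splice

variable {X : Type*}

/-- The sequence that follows the first one up to time `n`, and then restarts with the second. -/
def splice (n : ℕ) (w : (ℕ → X) × (ℕ → X)) : ℕ → X :=
  fun i => if i < n then w.1 i else w.2 (i - n)

theorem splice_of_lt {n i : ℕ} (h : i < n) (w : (ℕ → X) × (ℕ → X)) : splice n w i = w.1 i := by
  simp [splice, h]

theorem splice_add (n i : ℕ) (w : (ℕ → X) × (ℕ → X)) : splice n w (n + i) = w.2 i := by
  simp [splice]

variable [MeasurableSpace X]

theorem measurable_splice (n : ℕ) : Measurable (splice (X := X) n) := by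
  refine measurable_pi_lambda _ fun i => ?_
  by_cases h : i < n
  · simp only [splice, h, if_true]
    fun_prop
  · simp only [splice, h, if_false]
    fun_prop

variable (μ : Measure X) [IsProbabilityMeasure μ]

theorem map_splice (n : ℕ) :
    ((Measure.infinitePi fun _ : ℕ => μ).prod (Measure.infinitePi fun _ : ℕ => μ)).map (splice n) =
      Measure.infinitePi fun _ : ℕ => μ := by
  refine Measure.eq_infinitePi _ fun s t ht => ?_
  have hpre : splice n ⁻¹' (Set.pi s t) =
      (Set.pi (s.filter (· < n) : Finset ℕ) t) ×ˢ
        (Set.pi ((s.filter (¬ · < n)).image (· - n) : Finset ℕ) fun j => t (j + n)) := by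
    ext w
    simp only [Set.mem_preimage, Set.mem_pi, Finset.mem_coe, Set.mem_prod, Finset.mem_filter,
      Finset.mem_image, not_lt]
    constructor
    · intro h
      refine ⟨fun i hi => by simpa [splice, hi.2] using h i hi.1, ?_⟩
      rintro j ⟨i, ⟨his, hin⟩, rfl⟩
      simpa [splice, hin.not_gt, Nat.sub_add_cancel hin] using h i his
    · rintro ⟨h1, h2⟩ i hi
      by_cases hin : i < n
      · simpa [splice, hin] using h1 i ⟨hi, hin⟩
      · simpa [splice, hin, Nat.sub_add_cancel (not_lt.1 hin)] using
          h2 (i - n) ⟨i, ⟨hi, not_lt.1 hin⟩, rfl⟩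
  rw [Measure.map_apply (measurable_splice n)
    (MeasurableSet.pi s.countable_toSet fun i _ => ht i), hpre, Measure.prod_prod,
    Measure.infinitePi_pi _ fun i _ => ht i, Measure.infinitePi_pi _ fun i _ => ht _,
    Finset.prod_image, ← Finset.prod_filter_mul_prod_filter_not s (· < n)]
  · congr 1
    refine Finset.prod_congr rfl fun i hi => ?_
    rw [Nat.sub_add_cancel (not_lt.1 (Finset.mem_filter.1 hi).2)]
  · intro i hi j hj hij
    have hi' := not_lt.1 (Finset.mem_filter.1 hi).2
    have hj' := not_lt.1 (Finset.mem_filter.1 hj).2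
    simp only at hij
    omega

theorem infinitePi_apply_splice (n : ℕ) {s : Set (ℕ → X)} (hs : MeasurableSet s) :
    Measure.infinitePi (fun _ : ℕ => μ) s =
      ∫⁻ x, Measure.infinitePi (fun _ : ℕ => μ) {z | splice n (x, z) ∈ s}
        ∂Measure.infinitePi fun _ : ℕ => μ := by
  conv_lhs => rw [← map_splice μ n, Measure.map_apply (measurable_splice n) hs,
    Measure.prod_apply (measurable_splice n hs)]
  rfl

/-- An event of positive probability is nearly certain after a suitable finite past. -/
theorem exists_past_lt_measure {G : Set (ℕ → X)} (hG : MeasurableSet G)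
    (hpos : Measure.infinitePi (fun _ : ℕ => μ) G ≠ 0) {b : ℝ≥0∞} (hb : b < 1) (T : ℕ) :
    ∃ n, T ≤ n ∧ ∃ x, b < Measure.infinitePi (fun _ : ℕ => μ) {z | splice n (x, z) ∈ G} := by
  set P := Measure.infinitePi fun _ : ℕ => μ with hP
  by_contra! hcon
  have hle : ∀ ε : ℝ, 0 < ε → P G ≤ b * (P G + ENNReal.ofReal ε) + ENNReal.ofReal ε := by
    intro ε hε
    have hdense : P.MeasureDense (measurableCylinders fun _ : ℕ => X) :=
      Measure.MeasureDense.of_generateFrom_isSetAlgebra_finite _ isSetAlgebra_measurableCylinders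
        generateFrom_measurableCylinders.symm
    obtain ⟨H, hH, hGH⟩ := hdense.approx G hG (measure_ne_top _ _) ε hε
    have hHm : MeasurableSet H := hdense.measurable H hH
    obtain ⟨s, S, hS, rfl⟩ := (mem_measurableCylinders H).1 hH
    set n := max T (s.sup id + 1)
    have hn : ∀ i ∈ s, i < n := fun i hi =>
      lt_of_lt_of_le (Nat.lt_succ_of_le (Finset.le_sup (f := id) hi)) (le_max_right _ _)
    have hmem : ∀ x z : ℕ → X, splice n (x, z) ∈ cylinder s S ↔ x ∈ cylinder s S := by
      intro x z
      have : s.restrict (splice n (x, z)) = s.restrict x := by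
        funext i
        exact splice_of_lt (hn i i.2) _
      rw [mem_cylinder, mem_cylinder, this]
    have h1 : P (G ∩ cylinder s S) ≤ b * P (cylinder s S) := by
      rw [hP, infinitePi_apply_splice μ n (hG.inter hHm), ← hP]
      calc ∫⁻ x, P {z | splice n (x, z) ∈ G ∩ cylinder s S} ∂P
          ≤ ∫⁻ x, (cylinder s S).indicator (fun _ => b) x ∂P := by
            refine lintegral_mono fun x => ?_
            by_cases hx : x ∈ cylinder s S
            · rw [Set.indicator_of_mem hx]
              exact (measure_mono fun z hz => hz.1).trans (hcon n (le_max_left _ _) x)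
            · rw [Set.indicator_of_notMem hx]
              refine le_of_eq (measure_mono_null (t := ∅) (fun z hz => ?_) measure_empty)
              exact hx ((hmem x z).1 hz.2)
        _ = b * P (cylinder s S) := by
            rw [lintegral_indicator hHm, lintegral_const, Measure.restrict_apply_univ]
    have h2 : P G ≤ P (G ∩ cylinder s S) + ENNReal.ofReal ε := by
      refine (measure_mono (t := (G ∩ cylinder s S) ∪ symmDiff G (cylinder s S)) ?_).trans
        ((measure_union_le _ _).trans (by gcongr))
      intro y hy
      by_cases hyH : y ∈ cylinder s S
      · exact Or.inl ⟨hy, hyH⟩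
      · exact Or.inr (Or.inl ⟨hy, hyH⟩)
    have h3 : P (cylinder s S) ≤ P G + ENNReal.ofReal ε := by
      refine (measure_mono (t := G ∪ symmDiff G (cylinder s S)) ?_).trans
        ((measure_union_le _ _).trans (by gcongr))
      intro y hy
      by_cases hyG : y ∈ G
      · exact Or.inl hyG
      · exact Or.inr (Or.inr ⟨hy, hyG⟩)
    calc P G ≤ P (G ∩ cylinder s S) + ENNReal.ofReal ε := h2
      _ ≤ b * (P G + ENNReal.ofReal ε) + ENNReal.ofReal ε := by
        gcongr
        exact h1.trans (by gcongr)
  have hbt : b ≠ ∞ := ne_top_of_lt hb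
  have hle' : ∀ ε : ℝ, 0 < ε → P.real G ≤ b.toReal * (P.real G + ε) + ε := by
    intro ε hε
    have h := ENNReal.toReal_mono (by finiteness) (hle ε hε)
    rwa [ENNReal.toReal_add (by finiteness) (by finiteness), ENNReal.toReal_mul,
      ENNReal.toReal_add (by finiteness) (by finiteness), ENNReal.toReal_ofReal hε.le] at h
  have hp : 0 < P.real G := ENNReal.toReal_pos hpos (measure_ne_top _ _)
  have hb1 : b.toReal < 1 := by
    simpa using (ENNReal.toReal_lt_toReal hbt ENNReal.one_ne_top).2 hb
  have hb0 : 0 ≤ b.toReal := ENNReal.toReal_nonneg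
  have := hle' ((1 - b.toReal) * P.real G / 3) (by nlinarith [mul_pos (sub_pos.2 hb1) hp])
  nlinarith [mul_pos (sub_pos.2 hb1) hp]

end Splice

end ModelSwitching

namespace ModelSwitching

/-! ### Measurable functions of finite histories -/

/-- A function of finite lists is measurable if it is measurable on the lists of each length. -/
def ListMeasurable {X β : Type*} [MeasurableSpace X] [MeasurableSpace β] (F : List X → β) : Prop :=
  ∀ n, Measurable fun v : Fin n → X => F (List.ofFn v)

theorem ListMeasurable.comp {X β γ : Type*} [MeasurableSpace X] [MeasurableSpace β]
    [MeasurableSpace γ] {g : β → γ} (hg : Measurable g) {F : List X → β} (hF : ListMeasurable F) :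
    ListMeasurable fun l => g (F l) :=
  fun n => hg.comp (hF n)

/-- Functions defined by recursion along lists are measurable. -/
theorem ListMeasurable.of_rec {X β : Type*} [MeasurableSpace X] [MeasurableSpace β]
    {F : List X → β} {g : X → β → β} (hg : Measurable fun w : X × β => g w.1 w.2)
    (hF : ∀ x l, F (x :: l) = g x (F l)) : ListMeasurable F := by
  intro n
  induction n with
  | zero => simp
  | succ n ih =>
    simp only [List.ofFn_succ, hF]
    have htail : Measurable fun v : Fin (n + 1) → X => fun i : Fin n => v i.succ :=
      measurable_pi_lambda _ fun i => measurable_pi_apply i.succ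
    exact hg.comp (f := fun v : Fin (n + 1) → X => (v 0, F (List.ofFn fun i => v i.succ)))
      ((measurable_pi_apply 0).prodMk (ih.comp htail))

/-! ### Play of a strategy -/

section Play

variable {A Y : Type*}

/-- The history (most recent period first) at date `t` under the strategy `σ`, starting with the
history `h`. -/
def play (σ : List (A × Y) → A) (h : List (A × Y)) (y : ℕ → A → Y) : ℕ → List (A × Y)
  | 0 => h
  | t + 1 => (σ (play σ h y t), y t (σ (play σ h y t))) :: play σ h y t

theorem play_add (σ : List (A × Y) → A) (h : List (A × Y)) (y : ℕ → A → Y) (n t : ℕ) :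
    play σ h y (n + t) = play σ (play σ h y n) (fun i => y (n + i)) t := by
  induction t with
  | zero => rfl
  | succ t ih => rw [← add_assoc, play, play, ih]

theorem play_congr (σ : List (A × Y) → A) (h : List (A × Y)) {y y' : ℕ → A → Y} {n : ℕ}
    (hy : ∀ i < n, y i = y' i) : play σ h y n = play σ h y' n := by
  induction n with
  | zero => rfl
  | succ n ih => rw [play, play, ih fun i hi => hy i (hi.trans n.lt_succ_self),
      hy n n.lt_succ_self]

theorem play_splice (σ : List (A × Y) → A) (h : List (A × Y)) (x z : ℕ → A → Y) (n t : ℕ) :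
    play σ h (splice n (x, z)) (n + t) = play σ (play σ h x n) z t := by
  rw [play_add, play_congr σ h fun i hi => splice_of_lt hi (x, z)]
  congr 1
  funext i
  exact splice_add n i (x, z)

theorem history_eq_play [MeasurableSpace Y] {E : Environment A Y} (α : ℝ) (S : Role → Endowed E)
    (y : ℕ → A → Y) (t : ℕ) : history α S y t = play (action α S) [] y t := by
  induction t with
  | zero => rfl
  | succ t ih => simp only [history, play, ih]

variable [MeasurableSpace Y] [MeasurableSpace A] [DiscreteMeasurableSpace A] [Countable A]

theorem exists_play_eq_ofFn {σ : List (A × Y) → A} (hσ : ListMeasurable σ) (h : List (A × Y))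
    (t : ℕ) : ∃ n, ∃ v : (ℕ → A → Y) → Fin n → A × Y, Measurable v ∧
      ∀ y, play σ h y t = List.ofFn (v y) := by
  induction t with
  | zero => exact ⟨h.length, fun _ => h.get, measurable_const, fun y => (List.ofFn_get h).symm⟩
  | succ t ih =>
    obtain ⟨n, v, hv, hplay⟩ := ih
    have ha : Measurable fun y : ℕ → A → Y => σ (List.ofFn (v y)) := (hσ n).comp hv
    have hy : Measurable fun y : ℕ → A → Y => y t (σ (List.ofFn (v y))) := by
      have : Measurable fun w : A × (ℕ → A → Y) => w.2 t w.1 :=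
        measurable_from_prod_countable_right fun a => by simp only; fun_prop
      exact this.comp (ha.prodMk measurable_id)
    refine ⟨n + 1, fun y => Fin.cons (σ (List.ofFn (v y)), y t (σ (List.ofFn (v y)))) (v y),
      measurable_pi_lambda _ fun i => ?_, fun y => ?_⟩
    · refine Fin.cases ?_ (fun j => ?_) i
      · simpa using ha.prodMk hy
      · simp only [Fin.cons_succ]
        fun_prop
    · rw [play, hplay, List.ofFn_cons]

theorem ListMeasurable.play {β : Type*} [MeasurableSpace β] {F : List (A × Y) → β}
    (hF : ListMeasurable F) {σ : List (A × Y) → A} (hσ : ListMeasurable σ) (h : List (A × Y))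
    (t : ℕ) : Measurable fun y => F (play σ h y t) := by
  obtain ⟨n, v, hv, hplay⟩ := exists_play_eq_ofFn hσ h t
  simp only [hplay]
  exact (hF n).comp hv

instance [Fintype A] (E : Environment A Y) : IsProbabilityMeasure (outcomeLaw E) := by
  unfold outcomeLaw
  infer_instance

/-- Ville's maximal inequality for a process that is a nonnegative supermartingale whatever the
actions taken. -/
theorem outcomeLaw_exists_le_play [Fintype A] {E : Environment A Y} {σ : List (A × Y) → A}
    (hσ : ListMeasurable σ) {M : List (A × Y) → ℝ≥0∞} (hM : ListMeasurable M)
    (hsuper : ∀ h a, ∫⁻ y, M ((a, y) :: h) ∂E.law a ≤ M h) {c : ℝ≥0∞} (hc0 : c ≠ 0)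
    (hct : c ≠ ∞) (h : List (A × Y)) :
    outcomeLaw E {y | ∃ t, c ≤ M (play σ h y t)} ≤ M h / c := by
  have hfin : ∀ n h, outcomeLaw E {y | ∃ t ≤ n, c ≤ M (play σ h y t)} ≤ M h / c := by
    intro n
    induction n with
    | zero =>
      intro h
      by_cases hc : c ≤ M h
      · exact prob_le_one.trans ((ENNReal.le_div_iff_mul_le (Or.inl hc0) (Or.inl hct)).2
          (by simpa using hc))
      · simp [play, hc]
    | succ n ih =>
      intro h
      by_cases hc : c ≤ M h
      · exact prob_le_one.trans ((ENNReal.le_div_iff_mul_le (Or.inl hc0) (Or.inl hct)).2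
          (by simpa using hc))
      have hmeas : MeasurableSet {y | ∃ t ≤ n + 1, c ≤ M (play σ h y t)} := by
        have : {y | ∃ t ≤ n + 1, c ≤ M (play σ h y t)} =
            ⋃ t, ⋃ _ : t ≤ n + 1, {y | c ≤ M (play σ h y t)} := by
          ext y; simp
        rw [this]
        exact MeasurableSet.iUnion fun t => MeasurableSet.iUnion fun _ =>
          measurableSet_le measurable_const (hM.play hσ h t)
      have hone : ∀ x : ℕ → A → Y,
          outcomeLaw E {z | splice 1 (x, z) ∈ {y | ∃ t ≤ n + 1, c ≤ M (play σ h y t)}} ≤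
            M ((σ h, x 0 (σ h)) :: h) / c := by
        intro x
        refine (measure_mono fun z hz => ?_).trans (ih _)
        obtain ⟨t, ht, hle⟩ := hz
        cases t with
        | zero => exact absurd hle hc
        | succ t =>
          refine ⟨t, Nat.le_of_succ_le_succ ht, ?_⟩
          rw [add_comm t 1, play_splice] at hle
          exact hle
      have hMa : Measurable fun y => M ((σ h, y) :: h) := by
        have h1 := hM (h.length + 1)
        have h2 : Measurable fun y : Y => (Fin.cons (σ h, y) h.get : Fin (h.length + 1) → A × Y) :=
          measurable_pi_lambda _ fun i => by
            refine Fin.cases ?_ (fun j => ?_) i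
            · simp only [Fin.cons_zero]; fun_prop
            · simp only [Fin.cons_succ]; fun_prop
        simpa [Function.comp_def, List.ofFn_cons, List.ofFn_get] using h1.comp h2
      have heval : MeasurePreserving (fun x : ℕ → A → Y => x 0 (σ h)) (outcomeLaw E)
          (E.law (σ h)) :=
        (measurePreserving_eval (fun a => E.law a) (σ h)).comp
          (measurePreserving_eval_infinitePi (fun _ : ℕ => Measure.pi fun a => E.law a) 0)
      calc outcomeLaw E {y | ∃ t ≤ n + 1, c ≤ M (play σ h y t)}
          = ∫⁻ x, outcomeLaw E
              {z | splice 1 (x, z) ∈ {y | ∃ t ≤ n + 1, c ≤ M (play σ h y t)}} ∂outcomeLaw E :=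
            infinitePi_apply_splice _ 1 hmeas
        _ ≤ ∫⁻ x, M ((σ h, x 0 (σ h)) :: h) / c ∂outcomeLaw E := lintegral_mono hone
        _ = ∫⁻ y, M ((σ h, y) :: h) / c ∂E.law (σ h) :=
            heval.lintegral_comp (hMa.div_const c)
        _ ≤ M h / c := by
            simp only [div_eq_mul_inv]
            rw [lintegral_mul_const _ hMa]
            gcongr
            exact hsuper h (σ h)
  have hUnion : {y | ∃ t, c ≤ M (play σ h y t)} = ⋃ n, {y | ∃ t ≤ n, c ≤ M (play σ h y t)} := by
    ext y
    simp only [Set.mem_iUnion]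
    exact ⟨fun ⟨t, ht⟩ => ⟨t, t, le_rfl, ht⟩, fun ⟨_, t, _, ht⟩ => ⟨t, ht⟩⟩
  rw [hUnion, Monotone.measure_iUnion]
  · exact iSup_le fun n => hfin n h
  · rintro m n hmn y ⟨t, ht, hle⟩
    exact ⟨t, ht.trans hmn, hle⟩

end Play

/-! ### Measurability of beliefs, model choices and actions -/

section Measurability

variable {A Y : Type*} [MeasurableSpace Y] {E : Environment A Y}

theorem Model.measurable_bayes_apply (θ : Model E) (a : A) :
    Measurable fun w : Y × θ.Belief => θ.bayes a w.1 w.2 := by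
  have h : ∀ ω, Measurable fun w : Y × θ.Belief => w.2.1 ω * θ.q a ω w.1 := fun ω =>
    ((measurable_pi_apply ω).comp (measurable_subtype_coe.comp measurable_snd)).mul
      ((θ.measurable_q a ω).comp measurable_fst)
  refine Measurable.subtype_mk (measurable_pi_lambda _ fun ω => (h ω).div ?_)
  exact Finset.measurable_sum _ fun ω _ => h ω

variable [MeasurableSpace A] [DiscreteMeasurableSpace A] [Countable A]

theorem Model.listMeasurable_posterior (θ : Model E) (π : θ.Belief) :
    ListMeasurable (θ.posterior π) := by
  have h : Measurable fun w : A × Y × θ.Belief => θ.bayes w.1 w.2.1 w.2.2 :=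
    measurable_from_prod_countable_right fun a => θ.measurable_bayes_apply a
  refine ListMeasurable.of_rec (g := fun x π => θ.bayes x.1 x.2 π) ?_ fun x l => rfl
  exact h.comp (MeasurableEquiv.prodAssoc.measurable)

theorem listMeasurable_prod {β : Type*} [CommMonoid β] [MeasurableSpace β] [MeasurableMul₂ β]
    {f : A → Y → β} (hf : ∀ a, Measurable (f a)) :
    ListMeasurable fun h : List (A × Y) => (h.map fun x => f x.1 x.2).prod := by
  have h : Measurable fun w : A × Y => f w.1 w.2 := measurable_from_prod_countable_right hf
  refine ListMeasurable.of_rec (g := fun x b => f x.1 x.2 * b) ?_ fun x l => by simp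
  exact (h.comp measurable_fst).mul measurable_snd

theorem Endowed.listMeasurable_likelihood (e : Endowed E) : ListMeasurable e.likelihood :=
  fun n => Finset.measurable_sum _ fun ω _ =>
    (listMeasurable_prod (fun a => e.model.measurable_q a ω) n).const_mul _

theorem Endowed.listMeasurable_act (e : Endowed E)
    (he : ∀ a, MeasurableSet (e.policy ⁻¹' {a})) : ListMeasurable e.act :=
  (e.model.listMeasurable_posterior e.prior).comp (measurable_to_countable' he)

instance : MeasurableSpace Role := ⊤

instance : DiscreteMeasurableSpace Role := ⟨fun _ => trivial⟩

instance : Countable Role :=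
  Function.Injective.countable (f := fun r : Role => match r with
    | .initial => (0 : ℕ)
    | .competing => 1) (by intro a b h; cases a <;> cases b <;> simp_all)

theorem listMeasurable_modelChoice (α : ℝ) (S : Role → Endowed E) :
    ListMeasurable (modelChoice α S) := by
  intro n
  induction n with
  | zero => simp
  | succ n ih =>
    have hstep : Measurable fun w : Role × (Fin (n + 1) → A × Y) =>
        if α < (S w.1.other).likelihood (List.ofFn w.2) / (S w.1).likelihood (List.ofFn w.2)
          then w.1.other else w.1 :=
      measurable_from_prod_countable_right fun r => by
        exact Measurable.ite (measurableSet_lt measurable_const (((S r.other).listMeasurable_likelihood _).div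
          ((S r).listMeasurable_likelihood _))) (measurable_const (a := r.other))
          (measurable_const (a := r))
    have htail : Measurable fun v : Fin (n + 1) → A × Y => fun i : Fin n => v i.succ :=
      measurable_pi_lambda _ fun i => measurable_pi_apply i.succ
    convert! hstep.comp ((ih.comp htail).prodMk measurable_id) using 1
    funext v
    simp only [Function.comp_apply, id_eq, List.ofFn_succ, modelChoice]

theorem listMeasurable_action (α : ℝ) (S : Role → Endowed E)
    (hS : ∀ r a, MeasurableSet ((S r).policy ⁻¹' {a})) : ListMeasurable (action α S) := by
  intro n
  have h : Measurable fun w : Role × (Fin n → A × Y) => (S w.1).act (List.ofFn w.2) :=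
    measurable_from_prod_countable_right fun r => (S r).listMeasurable_act (hS r) n
  exact h.comp ((listMeasurable_modelChoice α S n).prodMk measurable_id)

end Measurability

end ModelSwitching

noncomputable section
namespace ModelSwitching

/-! ### Mixing a model with the truth -/

section Mixture

variable {A Y : Type*} [MeasurableSpace Y] {E : Environment A Y}

theorem withDensity_convexComb (ν : Measure Y) {f g : Y → ℝ} (hf : Measurable f)
    (hg : Measurable g) (hf0 : ∀ y, 0 < f y) (hg0 : ∀ y, 0 < g y) {η : ℝ} (h0 : 0 < η)
    (h1 : η < 1) :
    (ν.withDensity fun y => ENNReal.ofReal ((1 - η) * f y + η * g y)) =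
      ENNReal.ofReal (1 - η) • (ν.withDensity fun y => ENNReal.ofReal (f y)) +
        ENNReal.ofReal η • ν.withDensity fun y => ENNReal.ofReal (g y) := by
  rw [← withDensity_smul _ hf.ennreal_ofReal, ← withDensity_smul _ hg.ennreal_ofReal,
    ← withDensity_add_left (hf.ennreal_ofReal.const_smul _)]
  congr 1
  funext y
  simp only [Pi.add_apply, Pi.smul_apply, smul_eq_mul]
  rw [ENNReal.ofReal_add (mul_nonneg (sub_nonneg.2 h1.le) (hf0 y).le)
    (mul_nonneg h0.le (hg0 y).le), ENNReal.ofReal_mul (sub_nonneg.2 h1.le),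
    ENNReal.ofReal_mul h0.le]

theorem abs_log_div_convexComb_le {p q η : ℝ} (hp : 0 < p) (hq : 0 < q) (h0 : 0 < η)
    (h1 : η < 1) : |Real.log (p / ((1 - η) * q + η * p))| ≤ |Real.log (p / q)| := by
  have hm : 0 < (1 - η) * q + η * p := add_pos (mul_pos (sub_pos.2 h1) hq) (mul_pos h0 hp)
  rcases le_total q p with hqp | hpq
  · have hlo : q ≤ (1 - η) * q + η * p := by nlinarith
    have hhi : (1 - η) * q + η * p ≤ p := by nlinarith
    rw [abs_of_nonneg (Real.log_nonneg ((one_le_div hm).2 hhi)),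
      abs_of_nonneg (Real.log_nonneg ((one_le_div hq).2 hqp))]
    exact Real.log_le_log (div_pos hp hm) (div_le_div_of_nonneg_left hp.le hq hlo)
  · have hlo : p ≤ (1 - η) * q + η * p := by nlinarith
    have hhi : (1 - η) * q + η * p ≤ q := by nlinarith
    rw [abs_of_nonpos (Real.log_nonpos (div_pos hp hm).le ((div_le_one hm).2 hlo)),
      abs_of_nonpos (Real.log_nonpos (div_pos hp hq).le ((div_le_one hq).2 hpq)), neg_le_neg_iff]
    exact Real.log_le_log (div_pos hp hq) (div_le_div_of_nonneg_left hp.le hm hhi)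

namespace Model

/-- The model that mixes all predictions of `θ` with the truth, which gets weight `η`. -/
def mixTruth (θ : Model E) {η : ℝ} (h0 : 0 < η) (h1 : η < 1) : Model E where
  dim := θ.dim
  params := θ.params
  nonempty := θ.nonempty
  q a ω y := (1 - η) * θ.q a ω y + η * E.q a y
  measurable_q a ω := ((θ.measurable_q a ω).const_mul _).add ((E.measurable_q a).const_mul _)
  q_pos a ω y := add_pos (mul_pos (sub_pos.2 h1) (θ.q_pos a ω y)) (mul_pos h0 (E.q_pos a y))
  lintegral_q a ω := by
    have h := congrArg (fun μ : Measure Y => μ Set.univ)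
      (withDensity_convexComb E.ν (θ.measurable_q a ω) (E.measurable_q a) (θ.q_pos a ω)
        (E.q_pos a) h0 h1)
    simp only [Measure.add_apply, Measure.smul_apply, withDensity_apply _ MeasurableSet.univ,
      Measure.restrict_univ, θ.lintegral_q, E.lintegral_q, smul_eq_mul, mul_one] at h
    rw [h, ← ENNReal.ofReal_add (sub_nonneg.2 h1.le) h0.le, sub_add_cancel, ENNReal.ofReal_one]
  integrable_u a ω := by
    rw [withDensity_convexComb E.ν (θ.measurable_q a ω) (E.measurable_q a) (θ.q_pos a ω)
      (E.q_pos a) h0 h1]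
    exact ((θ.integrable_u a ω).smul_measure ENNReal.ofReal_ne_top).add_measure
      ((E.integrable_u a).smul_measure ENNReal.ofReal_ne_top)
  log_dominated a ω := by
    obtain ⟨g, hg, hle⟩ := θ.log_dominated a ω
    refine ⟨g, hg, hle.mono fun y hy => (abs_log_div_convexComb_le (E.q_pos a y)
      (θ.q_pos a ω y) h0 h1).trans hy⟩

theorem lawMeasure_mixTruth (θ : Model E) {η : ℝ} (h0 : 0 < η) (h1 : η < 1) (a : A)
    (ω : θ.params) : (θ.mixTruth h0 h1).lawMeasure a ω =
      ENNReal.ofReal (1 - η) • θ.lawMeasure a ω + ENNReal.ofReal η • E.law a :=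
  withDensity_convexComb E.ν (θ.measurable_q a ω) (E.measurable_q a) (θ.q_pos a ω)
    (E.q_pos a) h0 h1

end Model

end Mixture

section Distance

theorem levyProkhorovDist_sum_dirac_le {ι X : Type*} [Fintype ι] [PseudoMetricSpace X]
    [MeasurableSpace X] [OpensMeasurableSpace X] (w : ι → ℝ≥0∞) (f g : ι → X) {η : ℝ}
    (hη : 0 ≤ η) (hfg : ∀ i, dist (f i) (g i) ≤ η) :
    levyProkhorovDist (∑ i, w i • Measure.dirac (f i)) (∑ i, w i • Measure.dirac (g i)) ≤ η := by
  have key : ∀ (f g : ι → X), (∀ i, dist (f i) (g i) ≤ η) → ∀ (r : ℝ) (B : Set X), η < r →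
      MeasurableSet B → (∑ i, w i • Measure.dirac (f i)) B ≤
        (∑ i, w i • Measure.dirac (g i)) (Metric.thickening r B) := by
    intro f g hfg r B hr hB
    simp only [Measure.finsetSum_apply, Measure.smul_apply, smul_eq_mul,
      Measure.dirac_apply' _ hB, Measure.dirac_apply' _ Metric.isOpen_thickening.measurableSet]
    refine Finset.sum_le_sum fun i _ => ?_
    gcongr
    by_cases hi : f i ∈ B
    · have : g i ∈ Metric.thickening r B :=
        Metric.mem_thickening_iff.2 ⟨f i, hi, by rw [dist_comm]; exact (hfg i).trans_lt hr⟩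
      simp [hi, this]
    · simp [hi]
  refine ENNReal.toReal_le_of_le_ofReal hη (levyProkhorovEDist_le_of_forall _ _ _ ?_)
  intro ε B hε hεt hB
  have hr : η < ε.toReal := (ENNReal.ofReal_lt_iff_lt_toReal hη hεt.ne).1 hε
  exact ⟨(key f g hfg _ B hr hB).trans le_self_add,
    (key g f (fun i => by rw [dist_comm]; exact hfg i) _ B hr hB).trans le_self_add⟩

variable {A Y : Type*} [MeasurableSpace Y] {E : Environment A Y} [PseudoMetricSpace Y]
  [OpensMeasurableSpace Y]

theorem Model.dist_law_mixTruth_le (θ : Model E) {η : ℝ} (h0 : 0 < η) (h1 : η < 1) (a : A)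
    (ω : θ.params) : dist (LevyProkhorov.ofMeasure (θ.law a ω))
      (LevyProkhorov.ofMeasure ((θ.mixTruth h0 h1).law a ω)) ≤ η := by
  rw [LevyProkhorov.dist_probabilityMeasure_def]
  refine ENNReal.toReal_le_of_le_ofReal h0.le (levyProkhorovEDist_le_of_forall _ _ _ ?_)
  intro ε B hε hεt hB
  have hr : 0 < ε.toReal := ENNReal.toReal_pos (pos_of_gt hε).ne' hεt.ne
  have hsub : B ⊆ Metric.thickening ε.toReal B := Metric.self_subset_thickening hr B
  change θ.lawMeasure a ω B ≤ (θ.mixTruth h0 h1).lawMeasure a ω _ + ε ∧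
    (θ.mixTruth h0 h1).lawMeasure a ω B ≤ θ.lawMeasure a ω _ + ε
  have hprob : IsProbabilityMeasure (θ.lawMeasure a ω) := (θ.law a ω).2
  have hsum : ENNReal.ofReal (1 - η) + ENNReal.ofReal η = 1 := by
    rw [← ENNReal.ofReal_add (sub_nonneg.2 h1.le) h0.le, sub_add_cancel, ENNReal.ofReal_one]
  rw [θ.lawMeasure_mixTruth h0 h1]
  simp only [Measure.add_apply, Measure.smul_apply, smul_eq_mul]
  constructor
  · calc θ.lawMeasure a ω B
        = ENNReal.ofReal (1 - η) * θ.lawMeasure a ω B +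
            ENNReal.ofReal η * θ.lawMeasure a ω B := by rw [← add_mul, hsum, one_mul]
      _ ≤ ENNReal.ofReal (1 - η) * θ.lawMeasure a ω (Metric.thickening ε.toReal B) + ε := by
          gcongr
          exact (mul_le_of_le_one_right' prob_le_one).trans hε.le
      _ ≤ _ := by
          gcongr
          exact le_self_add
  · gcongr
    · refine (mul_le_of_le_one_left' ?_).trans (measure_mono hsub)
      exact hsum ▸ le_self_add
    · exact (mul_le_of_le_one_right' prob_le_one).trans hε.le

variable [Fintype A]

theorem Model.dist_profile_mixTruth_le (θ : Model E) {η : ℝ} (h0 : 0 < η) (h1 : η < 1)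
    (ω : θ.params) : dist (θ.profile ω) ((θ.mixTruth h0 h1).profile ω) ≤ η :=
  (dist_pi_le_iff h0.le).2 fun a => θ.dist_law_mixTruth_le h0 h1 a ω

theorem Model.neighborhood_mono (θ : Model E) {ε ε' : ℝ} (h : ε ≤ ε') :
    θ.neighborhood ε ⊆ θ.neighborhood ε' := by
  intro θ' hθ'
  have hle : Metric.hausdorffDist (Set.range θ.profile) (Set.range θ'.profile) ≤ ε := hθ'
  exact hle.trans h

theorem Model.nearbyBeliefs_mono (θ θ' : Model E) (π : θ.Belief) {ε ε' : ℝ} (h : ε ≤ ε') :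
    θ.nearbyBeliefs π θ' ε ⊆ θ.nearbyBeliefs π θ' ε' := by
  intro π' hπ'
  have hle : levyProkhorovDist (θ.inducedBelief π) (θ'.inducedBelief π') ≤ ε := hπ'
  exact hle.trans h

theorem Model.mixTruth_mem_neighborhood (θ : Model E) {η : ℝ} (h0 : 0 < η) (h1 : η < 1) :
    θ.mixTruth h0 h1 ∈ θ.neighborhood η := by
  refine Metric.hausdorffDist_le_of_mem_dist h0.le ?_ ?_
  · rintro _ ⟨ω, rfl⟩
    exact ⟨_, ⟨ω, rfl⟩, θ.dist_profile_mixTruth_le h0 h1 ω⟩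
  · rintro _ ⟨ω, rfl⟩
    exact ⟨_, ⟨ω, rfl⟩, (dist_comm _ _).trans_le (θ.dist_profile_mixTruth_le h0 h1 ω)⟩

theorem Model.mem_nearbyBeliefs_mixTruth (θ : Model E) {η : ℝ} (h0 : 0 < η) (h1 : η < 1)
    (π : θ.Belief) : π ∈ θ.nearbyBeliefs π (θ.mixTruth h0 h1) η :=
  levyProkhorovDist_sum_dirac_le (fun ω : θ.params => ENNReal.ofReal (π.1 ω)) θ.profile
    (θ.mixTruth h0 h1).profile h0.le (θ.dist_profile_mixTruth_le h0 h1)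

end Distance

end ModelSwitching
end

noncomputable section
namespace ModelSwitching

/-! ### Existence of optimal policies -/

namespace Model

variable {A Y : Type*} [MeasurableSpace Y] {E : Environment A Y} (θ : Model E)

instance (a : A) (ω : θ.params) : IsProbabilityMeasure (θ.lawMeasure a ω) := (θ.law a ω).2

theorem integral_mul_q (a : A) (ω : θ.params) (f : Y → ℝ) :
    ∫ y, f y * θ.q a ω y ∂E.ν = ∫ y, f y ∂θ.lawMeasure a ω := by
  rw [lawMeasure, integral_withDensity_eq_integral_toReal_smul
    (θ.measurable_q a ω).ennreal_ofReal (ae_of_all _ fun y => ENNReal.ofReal_lt_top)]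
  refine integral_congr_ae (ae_of_all _ fun y => ?_)
  simp only [ENNReal.toReal_ofReal (θ.q_pos a ω y).le, smul_eq_mul, mul_comm]

theorem measurable_bayes (a : A) (π : θ.Belief) : Measurable fun y => θ.bayes a y π :=
  (θ.measurable_bayes_apply a).comp (measurable_id.prodMk measurable_const)

variable {θ} in
theorem integrable_continuation {U : θ.Belief → ℝ} (hU : Measurable U) {C : ℝ}
    (hC : ∀ π, |U π| ≤ C) (a : A) (ω : θ.params) (π : θ.Belief) :
    Integrable (fun y => U (θ.bayes a y π)) (θ.lawMeasure a ω) :=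
  Integrable.of_bound (hU.comp (θ.measurable_bayes a π)).aestronglyMeasurable C
    (ae_of_all _ fun _ => hC _)

/-- Expected flow payoff of an action under a parameter. -/
def flow (a : A) (ω : θ.params) : ℝ := ∫ y, E.u a y ∂θ.lawMeasure a ω

variable {θ} in
theorem actionValue_eq {δ : ℝ} {U : θ.Belief → ℝ} (hU : Measurable U) {C : ℝ}
    (hC : ∀ π, |U π| ≤ C) (a : A) (π : θ.Belief) :
    θ.actionValue δ U a π =
      ∑ ω, π.1 ω * (θ.flow a ω + δ * ∫ y, U (θ.bayes a y π) ∂θ.lawMeasure a ω) := by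
  refine Finset.sum_congr rfl fun ω _ => ?_
  have hu : Integrable (E.u a) (θ.lawMeasure a ω) := θ.integrable_u a ω
  rw [θ.integral_mul_q, integral_add hu
    ((integrable_continuation hU hC a ω π).const_mul δ), integral_const_mul, flow]

variable {θ} in
theorem measurable_actionValue {δ : ℝ} {U : θ.Belief → ℝ} (hU : Measurable U) {C : ℝ}
    (hC : ∀ π, |U π| ≤ C) (a : A) : Measurable (θ.actionValue δ U a) := by
  have h : θ.actionValue δ U a = fun π => ∑ ω, π.1 ω *
      (θ.flow a ω + δ * ∫ y, U (θ.bayes a y π) ∂θ.lawMeasure a ω) :=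
    funext fun π => actionValue_eq hU hC a π
  rw [h]
  refine Finset.measurable_sum _ fun ω _ => ?_
  have h1 : Measurable fun w : θ.Belief × Y => U (θ.bayes a w.2 w.1) :=
    hU.comp ((θ.measurable_bayes_apply a).comp measurable_swap)
  have h2 : Measurable fun π : θ.Belief => ∫ y, U (θ.bayes a y π) ∂θ.lawMeasure a ω :=
    (h1.stronglyMeasurable.integral_prod_right' (ν := θ.lawMeasure a ω)).measurable
  exact ((measurable_pi_apply ω).comp measurable_subtype_coe).mul
    (measurable_const.add (h2.const_mul δ))

theorem abs_sum_belief_le (π : θ.Belief) {f : θ.params → ℝ} {C : ℝ} (hf : ∀ ω, |f ω| ≤ C) :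
    |∑ ω, π.1 ω * f ω| ≤ C := by
  calc |∑ ω, π.1 ω * f ω| ≤ ∑ ω, |π.1 ω * f ω| := Finset.abs_sum_le_sum_abs _ _
    _ ≤ ∑ ω, π.1 ω * C := Finset.sum_le_sum fun ω _ => by
        rw [abs_mul, abs_of_nonneg (π.2.1 ω)]
        exact mul_le_mul_of_nonneg_left (hf ω) (π.2.1 ω)
    _ = C := by rw [← Finset.sum_mul, show ∑ ω, π.1 ω = 1 from π.2.2, one_mul]

variable {θ} in
theorem abs_actionValue_sub_le {δ : ℝ} (hδ : 0 ≤ δ) {U V : θ.Belief → ℝ} (hU : Measurable U)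
    (hV : Measurable V) {C C' D : ℝ} (hC : ∀ π, |U π| ≤ C) (hC' : ∀ π, |V π| ≤ C')
    (hD : ∀ π, |U π - V π| ≤ D) (a : A) (π : θ.Belief) :
    |θ.actionValue δ U a π - θ.actionValue δ V a π| ≤ δ * D := by
  rw [actionValue_eq hU hC, actionValue_eq hV hC', ← Finset.sum_sub_distrib]
  simp only [← mul_sub]
  refine θ.abs_sum_belief_le π fun ω => ?_
  rw [add_sub_add_left_eq_sub, ← mul_sub, ← integral_sub (integrable_continuation hU hC a ω π)
    (integrable_continuation hV hC' a ω π), abs_mul, abs_of_nonneg hδ]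
  refine mul_le_mul_of_nonneg_left ?_ hδ
  have := norm_integral_le_of_norm_le_const (μ := θ.lawMeasure a ω)
    (f := fun y => U (θ.bayes a y π) - V (θ.bayes a y π)) (C := D) (ae_of_all _ fun y => hD (θ.bayes a y π))
  simpa using this

section Bellman

variable [Fintype A] [Nonempty A]

/-- The Bellman operator. -/
def bellmanOp (δ : ℝ) (U : θ.Belief → ℝ) (π : θ.Belief) : ℝ :=
  Finset.univ.sup' Finset.univ_nonempty fun a => θ.actionValue δ U a π

variable {θ}

theorem isGreatest_bellmanOp (δ : ℝ) (U : θ.Belief → ℝ) (π : θ.Belief) :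
    IsGreatest (Set.range fun a => θ.actionValue δ U a π) (θ.bellmanOp δ U π) := by
  constructor
  · obtain ⟨a, -, ha⟩ := Finset.exists_mem_eq_sup' Finset.univ_nonempty
      fun a => θ.actionValue δ U a π
    exact ⟨a, ha.symm⟩
  · rintro _ ⟨a, rfl⟩
    exact Finset.le_sup' (fun a => θ.actionValue δ U a π) (Finset.mem_univ a)

theorem measurable_bellmanOp {δ : ℝ} {U : θ.Belief → ℝ} (hU : Measurable U) {C : ℝ}
    (hC : ∀ π, |U π| ≤ C) : Measurable (θ.bellmanOp δ U) := by
  have h := Finset.measurable_sup' (Finset.univ_nonempty (α := A))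
    fun a _ => measurable_actionValue (δ := δ) hU hC a
  convert! h using 1
  funext π
  rw [Finset.sup'_apply]
  rfl

theorem abs_bellmanOp_sub_le {δ : ℝ} (hδ : 0 ≤ δ) {U V : θ.Belief → ℝ} (hU : Measurable U)
    (hV : Measurable V) {C C' D : ℝ} (hC : ∀ π, |U π| ≤ C) (hC' : ∀ π, |V π| ≤ C')
    (hD : ∀ π, |U π - V π| ≤ D) (π : θ.Belief) :
    |θ.bellmanOp δ U π - θ.bellmanOp δ V π| ≤ δ * D := by
  obtain ⟨⟨a, ha⟩, hUub⟩ := isGreatest_bellmanOp δ U π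
  obtain ⟨⟨b, hb⟩, hVub⟩ := isGreatest_bellmanOp δ V π
  have h1 := hVub ⟨a, rfl⟩
  have h2 := hUub ⟨b, rfl⟩
  have h3 := abs_le.1 (abs_actionValue_sub_le hδ hU hV hC hC' hD a π)
  have h4 := abs_le.1 (abs_actionValue_sub_le hδ hU hV hC hC' hD b π)
  simp only at ha hb h1 h2
  exact abs_le.2 ⟨by linarith, by linarith⟩

variable (θ) in
theorem exists_isValueFunction {δ : ℝ} (hδ0 : 0 ≤ δ) (hδ1 : δ < 1) :
    ∃ U, θ.IsValueFunction δ U := by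
  set V : ℕ → θ.Belief → ℝ := fun n => (θ.bellmanOp δ)^[n] 0 with hV
  have hVs : ∀ n, V (n + 1) = θ.bellmanOp δ (V n) := fun n => Function.iterate_succ_apply' _ _ _
  set K := ∑ a, ∑ ω, |θ.flow a ω|
  have hK : ∀ a ω, |θ.flow a ω| ≤ K := fun a ω =>
    (Finset.single_le_sum (f := fun ω => |θ.flow a ω|) (fun _ _ => abs_nonneg _)
      (Finset.mem_univ ω)).trans
    (Finset.single_le_sum (f := fun a => ∑ ω, |θ.flow a ω|)
      (fun _ _ => Finset.sum_nonneg fun _ _ => abs_nonneg _) (Finset.mem_univ a))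
  have h0 : ∀ π : θ.Belief, |(0 : θ.Belief → ℝ) π| ≤ 0 := fun π => by simp
  have hT0 : ∀ π, |θ.bellmanOp δ 0 π| ≤ K := by
    intro π
    obtain ⟨⟨a, ha⟩, -⟩ := isGreatest_bellmanOp δ (0 : θ.Belief → ℝ) π
    rw [← ha]
    simp only
    rw [actionValue_eq measurable_zero h0]
    exact θ.abs_sum_belief_le π fun ω => by simpa using hK a ω
  have hmb : ∀ n, Measurable (V n) ∧ ∃ C, ∀ π, |V n π| ≤ C := by
    intro n
    induction n with
    | zero => exact ⟨measurable_zero, 0, h0⟩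
    | succ n ih =>
      obtain ⟨hm, C, hC⟩ := ih
      rw [hVs]
      refine ⟨measurable_bellmanOp hm hC, K + δ * C, fun π => ?_⟩
      have h1 := abs_bellmanOp_sub_le hδ0 hm measurable_zero hC h0 (D := C)
        (fun π => by simpa using hC π) π
      have h2 := hT0 π
      rw [abs_le] at *
      constructor <;> linarith [h1.1, h1.2, h2.1, h2.2]
  have hstep : ∀ n π, |V (n + 1) π - V n π| ≤ K * δ ^ n := by
    intro n
    induction n with
    | zero =>
      intro π
      simpa [hV] using hT0 π
    | succ n ih =>
      intro π
      obtain ⟨hm, C, hC⟩ := hmb n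
      obtain ⟨hm', C', hC'⟩ := hmb (n + 1)
      have := abs_bellmanOp_sub_le hδ0 hm' hm hC' hC ih π
      rw [← hVs, ← hVs] at this
      exact this.trans_eq (by ring)
  have hdist : ∀ π n, dist (V n π) (V (n + 1) π) ≤ K * δ ^ n := fun π n => by
    rw [dist_comm, Real.dist_eq]
    exact hstep n π
  choose U hU using fun π => cauchySeq_tendsto_of_complete
    (cauchySeq_of_le_geometric δ K hδ1 (hdist π))
  have hUV : ∀ n π, |U π - V n π| ≤ K * δ ^ n / (1 - δ) := fun n π => by
    rw [← Real.dist_eq, dist_comm]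
    exact dist_le_of_le_geometric_of_tendsto δ K hδ1 (hdist π) (hU π) n
  have hUm : Measurable U :=
    measurable_of_tendsto_metrizable (fun n => (hmb n).1) (tendsto_pi_nhds.2 hU)
  have hUb : ∀ π, |U π| ≤ K / (1 - δ) := fun π => by simpa [hV] using hUV 0 π
  have hfix : ∀ π, θ.bellmanOp δ U π = U π := by
    intro π
    have h1 : Tendsto (fun n => V (n + 1) π) atTop (nhds (θ.bellmanOp δ U π)) := by
      rw [tendsto_iff_dist_tendsto_zero]
      have hz : Tendsto (fun n : ℕ => δ * (K * δ ^ n / (1 - δ))) atTop (nhds 0) := by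
        have := (tendsto_pow_atTop_nhds_zero_of_lt_one hδ0 hδ1).const_mul (δ * K / (1 - δ))
        rw [mul_zero] at this
        exact this.congr fun n => by ring
      refine squeeze_zero (fun _ => dist_nonneg) (fun n => ?_) hz
      obtain ⟨hm, C, hC⟩ := hmb n
      rw [hVs, dist_comm, Real.dist_eq]
      exact abs_bellmanOp_sub_le hδ0 hUm hm hUb hC (hUV n) π
    exact tendsto_nhds_unique h1 ((tendsto_add_atTop_iff_nat 1).2 (hU π))
  exact ⟨U, hUm, ⟨_, hUb⟩, fun π => hfix π ▸ isGreatest_bellmanOp δ U π⟩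

variable (θ) in
theorem exists_isOptimalPolicy {δ : ℝ} (hδ0 : 0 ≤ δ) (hδ1 : δ < 1) :
    ∃ p, θ.IsOptimalPolicy δ p := by
  obtain ⟨U, hU⟩ := θ.exists_isValueFunction hδ0 hδ1
  obtain ⟨C, hC⟩ := hU.bounded
  have hp : ∀ π, ∃ a, θ.actionValue δ U a π = U π ∧
      ∀ b, θ.actionValue δ U b π = U π → Fintype.equivFin A a ≤ Fintype.equivFin A b := by
    intro π
    classical
    obtain ⟨a₀, ha₀⟩ := (hU.bellman π).1
    obtain ⟨a, ha, hmin⟩ := Finset.exists_min_image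
      (Finset.univ.filter fun a => θ.actionValue δ U a π = U π) (Fintype.equivFin A)
      ⟨a₀, by simpa using ha₀⟩
    exact ⟨a, by simpa using ha, fun b hb => hmin b (by simpa using hb)⟩
  choose p hopt hmin using hp
  refine ⟨p, fun a => ?_, U, hU, hopt⟩
  have hset : p ⁻¹' {a} = {π | θ.actionValue δ U a π = U π} ∩
      ⋂ b, ⋂ _ : Fintype.equivFin A b < Fintype.equivFin A a,
        {π | θ.actionValue δ U b π = U π}ᶜ := by
    ext π
    simp only [Set.mem_preimage, Set.mem_singleton_iff, Set.mem_inter_iff, Set.mem_iInter,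
      Set.mem_compl_iff]
    constructor
    · rintro rfl
      exact ⟨hopt π, fun b hb hb' => (hmin π b hb').not_gt hb⟩
    · rintro ⟨h1, h2⟩
      refine (Fintype.equivFin A).injective (le_antisymm (hmin π a h1) ?_)
      by_contra! hlt
      exact h2 _ hlt (hopt π)
  have hm : ∀ b, MeasurableSet {π | θ.actionValue δ U b π = U π} := fun b =>
    measurableSet_eq_fun (measurable_actionValue hU.measurable hC b) hU.measurable
  rw [hset]
  exact (hm a).inter (MeasurableSet.iInter fun b => MeasurableSet.iInter fun _ => (hm b).compl)

end Bellman

end Model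

end ModelSwitching
end

noncomputable section
namespace ModelSwitching

variable {A Y : Type*} [MeasurableSpace Y] {E : Environment A Y}

/-! ### Likelihoods and posteriors -/

namespace Model

variable (θ : Model E)

/-- Likelihood of a history under one parameter. -/
def paramLikelihood (ω : θ.params) (h : List (A × Y)) : ℝ :=
  (h.map fun x => θ.q x.1 ω x.2).prod

@[simp]
theorem paramLikelihood_nil (ω : θ.params) : θ.paramLikelihood ω [] = 1 := rfl

@[simp]
theorem paramLikelihood_cons (ω : θ.params) (x : A × Y) (h : List (A × Y)) :
    θ.paramLikelihood ω (x :: h) = θ.q x.1 ω x.2 * θ.paramLikelihood ω h := by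
  simp [paramLikelihood]

theorem paramLikelihood_pos (ω : θ.params) (h : List (A × Y)) : 0 < θ.paramLikelihood ω h := by
  induction h with
  | nil => simp
  | cons x h ih => rw [paramLikelihood_cons]; exact mul_pos (θ.q_pos _ _ _) ih

theorem likelihood_eq (π : θ.Belief) (h : List (A × Y)) :
    θ.likelihood π h = ∑ ω, π.1 ω * θ.paramLikelihood ω h := rfl

theorem sum_mul_paramLikelihood_le (π : θ.Belief) (s : Finset θ.params) (h : List (A × Y)) :
    ∑ ω ∈ s, π.1 ω * θ.paramLikelihood ω h ≤ θ.likelihood π h :=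
  Finset.sum_le_sum_of_subset_of_nonneg (Finset.subset_univ s) fun ω _ _ =>
    mul_nonneg (π.2.1 ω) (θ.paramLikelihood_pos ω h).le

theorem likelihood_pos (π : θ.Belief) (h : List (A × Y)) : 0 < θ.likelihood π h := by
  obtain ⟨ω, hω⟩ : ∃ ω, π.1 ω ≠ 0 := by
    by_contra! hz
    have h1 : ∑ ω, π.1 ω = 1 := π.2.2
    simp [hz] at h1
  refine lt_of_lt_of_le ?_ (θ.sum_mul_paramLikelihood_le π {ω} h)
  rw [Finset.sum_singleton]
  exact mul_pos (lt_of_le_of_ne (π.2.1 ω) hω.symm) (θ.paramLikelihood_pos ω h)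

theorem posterior_apply (π : θ.Belief) (h : List (A × Y)) (ω : θ.params) :
    (θ.posterior π h).1 ω = π.1 ω * θ.paramLikelihood ω h / θ.likelihood π h := by
  induction h generalizing ω with
  | nil =>
    have h1 : ∑ ω, π.1 ω = 1 := π.2.2
    simp only [posterior, likelihood_eq, paramLikelihood_nil, mul_one, h1, div_one]
  | cons x h ih =>
    have hL := (θ.likelihood_pos π h).ne'
    have hpred : θ.predictive (θ.posterior π h) x.1 x.2 =
        θ.likelihood π (x :: h) / θ.likelihood π h := by
      rw [predictive, likelihood_eq, Finset.sum_div]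
      refine Finset.sum_congr rfl fun ω' _ => ?_
      rw [ih, paramLikelihood_cons]
      ring
    have hL' := (θ.likelihood_pos π (x :: h)).ne'
    change (θ.posterior π h).1 ω * θ.q x.1 ω x.2 / θ.predictive (θ.posterior π h) x.1 x.2 = _
    rw [hpred, ih, paramLikelihood_cons]
    field_simp

theorem posterior_append (π : θ.Belief) (l h : List (A × Y)) :
    θ.posterior π (l ++ h) = θ.posterior (θ.posterior π h) l := by
  induction l with
  | nil => rfl
  | cons x l ih => rw [List.cons_append, posterior, posterior, ih]

variable {θ} in
theorem FullSupport.posterior {π : θ.Belief} (hπ : θ.FullSupport π) (h : List (A × Y)) :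
    θ.FullSupport (θ.posterior π h) := fun ω => by
  rw [posterior_apply]
  exact div_pos (mul_pos (hπ ω) (θ.paramLikelihood_pos ω h)) (θ.likelihood_pos π h)

/-- The parameter `ω` predicts the outcome of the action `a` correctly. -/
def Correct (a : A) (ω : θ.params) : Prop := θ.q a ω =ᵐ[E.ν] E.q a

/-- The play of an agent who never abandons `θ`. -/
def dogmatic (π : θ.Belief) (p : θ.Belief → A) (h : List (A × Y)) : A := p (θ.posterior π h)

end Model

/-- The true likelihood of a history. -/
def Environment.likelihood (E : Environment A Y) (h : List (A × Y)) : ℝ :=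
  (h.map fun x => E.q x.1 x.2).prod

@[simp]
theorem Environment.likelihood_nil : E.likelihood [] = 1 := rfl

@[simp]
theorem Environment.likelihood_cons (x : A × Y) (h : List (A × Y)) :
    E.likelihood (x :: h) = E.q x.1 x.2 * E.likelihood h := by
  simp [Environment.likelihood]

theorem Environment.likelihood_pos (h : List (A × Y)) : 0 < E.likelihood h := by
  induction h with
  | nil => simp
  | cons x h ih => rw [likelihood_cons]; exact mul_pos (E.q_pos _ _) ih

theorem Environment.lintegral_law (a : A) {f : Y → ℝ} (hf : Measurable f) :
    ∫⁻ y, ENNReal.ofReal (f y) ∂E.law a = ∫⁻ y, ENNReal.ofReal (E.q a y * f y) ∂E.ν := by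
  rw [Environment.law, lintegral_withDensity_eq_lintegral_mul _ (E.measurable_q a).ennreal_ofReal
    hf.ennreal_ofReal]
  refine lintegral_congr fun y => ?_
  rw [Pi.mul_apply, ENNReal.ofReal_mul (E.q_pos a y).le]

/-! ### Product supermartingales -/

section ProductMartingale

theorem lintegral_sum_prod_le {ι : Type*} [Fintype ι] (w : ι → ℝ≥0∞) {f : ι → A → Y → ℝ≥0∞}
    (hf : ∀ i a, Measurable (f i a)) (hf1 : ∀ i a, ∫⁻ y, f i a y ∂E.law a ≤ 1)
    (h : List (A × Y)) (a : A) :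
    ∫⁻ y, ∑ i, w i * (((a, y) :: h).map fun x => f i x.1 x.2).prod ∂E.law a ≤
      ∑ i, w i * (h.map fun x => f i x.1 x.2).prod := by
  simp only [List.map_cons, List.prod_cons]
  rw [lintegral_finsetSum _ fun i _ => ((hf i a).mul_const _).const_mul _]
  refine Finset.sum_le_sum fun i _ => ?_
  rw [lintegral_const_mul _ ((hf i a).mul_const _), lintegral_mul_const _ (hf i a)]
  gcongr
  exact mul_le_of_le_one_left' (hf1 i a)

variable [MeasurableSpace A] [DiscreteMeasurableSpace A]

theorem listMeasurable_sum_prod [Countable A] {ι : Type*} [Fintype ι] (w : ι → ℝ≥0∞)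
    {f : ι → A → Y → ℝ≥0∞} (hf : ∀ i a, Measurable (f i a)) :
    ListMeasurable fun h : List (A × Y) => ∑ i, w i * (h.map fun x => f i x.1 x.2).prod :=
  fun n => Finset.measurable_sum _ fun i _ => (listMeasurable_prod (hf i) n).const_mul _

theorem ae_exists_play_lt [Fintype A] {σ : List (A × Y) → A} (hσ : ListMeasurable σ)
    {M : List (A × Y) → ℝ≥0∞} (hM : ListMeasurable M)
    (hsuper : ∀ h a, ∫⁻ y, M ((a, y) :: h) ∂E.law a ≤ M h) {h : List (A × Y)} (hh : M h ≠ ∞) :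
    ∀ᵐ y ∂outcomeLaw E, ∃ B : ℕ, ∀ t, M (play σ h y t) < B := by
  rw [ae_iff]
  push Not
  by_contra hne
  obtain ⟨B, hB⟩ := ENNReal.exists_nat_mul_gt hne hh
  have hB0 : (B : ℝ≥0∞) ≠ 0 := by
    rintro h0
    simp [h0] at hB
  refine hB.not_ge ?_
  rw [mul_comm, ← ENNReal.le_div_iff_mul_le (Or.inl hB0) (Or.inl (ENNReal.natCast_ne_top B))]
  exact (measure_mono fun y (hy : ∀ B : ℕ, ∃ t, (B : ℝ≥0∞) ≤ M (play σ h y t)) => hy B).trans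
    (outcomeLaw_exists_le_play hσ hM hsuper hB0 (ENNReal.natCast_ne_top B) h)

end ProductMartingale

/-! ### Persistence from an absorbing set of correct predictions -/

section Sufficiency

theorem ae_correct_eq [Fintype A] (θ : Model E) : ∀ᵐ y ∂outcomeLaw E, ∀ t a ω, θ.Correct a ω →
    θ.q a ω (y t a) = E.q a (y t a) := by
  refine ae_all_iff.2 fun t => ae_all_iff.2 fun a => ae_all_iff.2 fun ω => ?_
  by_cases hc : θ.Correct a ω
  · have heval : MeasurePreserving (fun x : ℕ → A → Y => x t a) (outcomeLaw E) (E.law a) :=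
      (measurePreserving_eval (fun a => E.law a) a).comp
        (measurePreserving_eval_infinitePi (fun _ : ℕ => Measure.pi fun a => E.law a) t)
    have hlaw : ∀ᵐ y ∂E.law a, θ.q a ω y = E.q a y :=
      (withDensity_absolutelyContinuous _ _).ae_le hc
    exact (heval.quasiMeasurePreserving.ae hlaw).mono fun y hy _ => hy
  · exact ae_of_all _ fun y h => absurd h hc

theorem paramLikelihood_play_eq {θ : Model E} {ω : θ.params} {σ : List (A × Y) → A}
    {y : ℕ → A → Y} (hy : ∀ t a ω, θ.Correct a ω → θ.q a ω (y t a) = E.q a (y t a))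
    (hσ : ∀ t, θ.Correct (σ (play σ [] y t)) ω) (t : ℕ) :
    θ.paramLikelihood ω (play σ [] y t) = E.likelihood (play σ [] y t) := by
  induction t with
  | zero => rfl
  | succ t ih =>
    rw [play, Model.paramLikelihood_cons, Environment.likelihood_cons, ih, hy t _ ω (hσ t)]

/-- Likelihood ratio of a model and the truth. -/
def truthRatio (e : Endowed E) (h : List (A × Y)) : ℝ≥0∞ :=
  ∑ ω, ENNReal.ofReal (e.prior.1 ω) *
    (h.map fun x => ENNReal.ofReal (e.model.q x.1 ω x.2 / E.q x.1 x.2)).prod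

theorem truthRatio_eq (e : Endowed E) (h : List (A × Y)) :
    truthRatio e h = ENNReal.ofReal (e.likelihood h / E.likelihood h) := by
  have hprod : ∀ ω, (h.map fun x => ENNReal.ofReal (e.model.q x.1 ω x.2 / E.q x.1 x.2)).prod =
      ENNReal.ofReal (e.model.paramLikelihood ω h / E.likelihood h) := by
    intro ω
    induction h with
    | nil => simp
    | cons x h ih =>
      rw [List.map_cons, List.prod_cons, ih, Model.paramLikelihood_cons,
        Environment.likelihood_cons, ← ENNReal.ofReal_mul
          (div_pos (e.model.q_pos _ _ _) (E.q_pos _ _)).le, div_mul_div_comm]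
  have hpos : ∀ ω, 0 ≤ e.model.paramLikelihood ω h / E.likelihood h := fun ω =>
    (div_pos (e.model.paramLikelihood_pos ω h) (E.likelihood_pos h)).le
  rw [truthRatio, Endowed.likelihood, Model.likelihood_eq, Finset.sum_div,
    ENNReal.ofReal_sum_of_nonneg fun ω _ => by
      rw [mul_div_assoc]; exact mul_nonneg (e.prior.2.1 ω) (hpos ω)]
  refine Finset.sum_congr rfl fun ω _ => ?_
  rw [hprod, mul_div_assoc, ENNReal.ofReal_mul (e.prior.2.1 ω)]

theorem truthRatio_nil (e : Endowed E) : truthRatio e [] = 1 := by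
  have h1 : ∑ ω, e.prior.1 ω = 1 := e.prior.2.2
  simp only [truthRatio_eq, Endowed.likelihood, Model.likelihood_eq, Model.paramLikelihood_nil,
    mul_one, h1, Environment.likelihood_nil, div_one, ENNReal.ofReal_one]

theorem measurable_q_div (e : Endowed E) (ω : e.model.params) (a : A) :
    Measurable fun y => ENNReal.ofReal (e.model.q a ω y / E.q a y) :=
  ((e.model.measurable_q a ω).div (E.measurable_q a)).ennreal_ofReal

theorem lintegral_q_div (e : Endowed E) (ω : e.model.params) (a : A) :
    ∫⁻ y, ENNReal.ofReal (e.model.q a ω y / E.q a y) ∂E.law a ≤ 1 := by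
  rw [E.lintegral_law a (f := fun y => e.model.q a ω y / E.q a y)
    ((e.model.measurable_q a ω).div (E.measurable_q a)), ← e.model.lintegral_q a ω]
  refine lintegral_mono fun y => ?_
  rw [mul_div_cancel₀ _ (E.q_pos a y).ne']

theorem modelChoice_eq_initial {α : ℝ} {θ : Model E} {π : θ.Belief} {p : θ.Belief → A}
    {C : Endowed E} {s : Finset θ.params} {b : ℝ} (hb : 0 < b) (hs : b < ∑ ω ∈ s, π.1 ω)
    {y : ℕ → A → Y} (hy : ∀ t a ω, θ.Correct a ω → θ.q a ω (y t a) = E.q a (y t a))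
    (hcorrect : ∀ t, ∀ ω ∈ s,
      θ.Correct (θ.dogmatic π p (play (θ.dogmatic π p) [] y t)) ω)
    (hratio : ∀ t, truthRatio C (play (θ.dogmatic π p) [] y t) < ENNReal.ofReal (α * b)) (t : ℕ) :
    history α (switcher ⟨θ, π, p⟩ C) y t = play (θ.dogmatic π p) [] y t ∧
      modelChoice α (switcher ⟨θ, π, p⟩ C) (history α (switcher ⟨θ, π, p⟩ C) y t) =
        .initial := by
  induction t with
  | zero => exact ⟨rfl, rfl⟩
  | succ t ih =>
    obtain ⟨hh, hm⟩ := ih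
    have hact : action α (switcher ⟨θ, π, p⟩ C) (history α (switcher ⟨θ, π, p⟩ C) y t) =
        θ.dogmatic π p (play (θ.dogmatic π p) [] y t) := by
      rw [action, hm, hh]
      rfl
    have hh' : history α (switcher ⟨θ, π, p⟩ C) y (t + 1) =
        play (θ.dogmatic π p) [] y (t + 1) := by
      rw [history, play, hact, hh]
    refine ⟨hh', ?_⟩
    set g := play (θ.dogmatic π p) [] y (t + 1) with hg
    have hE := E.likelihood_pos g
    have hC : C.likelihood g < α * b * E.likelihood g := by
      have h := hratio (t + 1)
      rw [truthRatio_eq] at h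
      rw [← div_lt_iff₀ hE]
      exact (ENNReal.ofReal_lt_ofReal_iff_of_nonneg
        (div_pos (C.model.likelihood_pos C.prior g) hE).le).1 h
    have hθ : b * E.likelihood g < θ.likelihood π g := by
      calc b * E.likelihood g < (∑ ω ∈ s, π.1 ω) * E.likelihood g :=
            mul_lt_mul_of_pos_right hs hE
        _ = ∑ ω ∈ s, π.1 ω * θ.paramLikelihood ω g := by
            rw [Finset.sum_mul]
            refine Finset.sum_congr rfl fun ω hω => ?_
            rw [hg, paramLikelihood_play_eq hy (fun t => hcorrect t ω hω)]
        _ ≤ θ.likelihood π g := θ.sum_mul_paramLikelihood_le π s g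
    have hθpos := θ.likelihood_pos π g
    have hα : 0 < α := by
      have h1 := (C.model.likelihood_pos C.prior g).trans hC
      have h2 : 0 < α * (b * E.likelihood g) := by rwa [← mul_assoc]
      exact pos_of_mul_pos_left h2 (mul_pos hb hE).le
    have hle : ¬ α < C.likelihood g / θ.likelihood π g := by
      rw [not_lt, div_le_iff₀ hθpos]
      nlinarith
    have hstep : modelChoice α (switcher ⟨θ, π, p⟩ C)
        (history α (switcher ⟨θ, π, p⟩ C) y (t + 1)) =
        if α < (switcher ⟨θ, π, p⟩ C (modelChoice α (switcher ⟨θ, π, p⟩ C)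
            (history α (switcher ⟨θ, π, p⟩ C) y t)).other).likelihood
              (history α (switcher ⟨θ, π, p⟩ C) y (t + 1)) /
            (switcher ⟨θ, π, p⟩ C (modelChoice α (switcher ⟨θ, π, p⟩ C)
            (history α (switcher ⟨θ, π, p⟩ C) y t))).likelihood
              (history α (switcher ⟨θ, π, p⟩ C) y (t + 1))
          then (modelChoice α (switcher ⟨θ, π, p⟩ C)
            (history α (switcher ⟨θ, π, p⟩ C) y t)).other
          else modelChoice α (switcher ⟨θ, π, p⟩ C)
            (history α (switcher ⟨θ, π, p⟩ C) y t) := rfl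
    rw [hstep, hm, hh']
    exact if_neg hle

/-- If the dogmatic play of `θ` stays, with high probability, among the actions whose outcomes are
correctly predicted by a set of parameters of high prior weight, then `θ` persists against any
model. -/
theorem persists_of_absorbing [Fintype A] {α : ℝ} {θ : Model E} {π : θ.Belief} {p : θ.Belief → A}
    (hp : ∀ a, MeasurableSet (p ⁻¹' {a})) {s : Finset θ.params} {b : ℝ} (hb : 0 < b)
    (hα : 1 ≤ α * b ^ 2) (hs : b < ∑ ω ∈ s, π.1 ω)
    (hprob : ENNReal.ofReal b < outcomeLaw E {y | ∀ t, ∀ ω ∈ s,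
      θ.Correct (θ.dogmatic π p (play (θ.dogmatic π p) [] y t)) ω}) (C : Endowed E) :
    Persists α ⟨θ, π, p⟩ C := by
  let _ : MeasurableSpace A := ⊤
  have : DiscreteMeasurableSpace A := ⟨fun _ => trivial⟩
  refine pos_iff_ne_zero.2 fun hzero => hprob.not_ge ?_
  have hαb : 0 < α * b := by nlinarith
  have hσ : ListMeasurable (θ.dogmatic π p) :=
    Endowed.listMeasurable_act (⟨θ, π, p⟩ : Endowed E) hp
  have hville := outcomeLaw_exists_le_play hσ (M := truthRatio C)
    (listMeasurable_sum_prod _ fun ω a => measurable_q_div C ω a)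
    (fun h a => lintegral_sum_prod_le _ (fun ω a => measurable_q_div C ω a)
      (fun ω a => lintegral_q_div C ω a) h a)
    (c := ENNReal.ofReal (α * b)) (by simpa using hαb) ENNReal.ofReal_ne_top []
  calc outcomeLaw E {y | ∀ t, ∀ ω ∈ s,
        θ.Correct (θ.dogmatic π p (play (θ.dogmatic π p) [] y t)) ω}
      ≤ outcomeLaw E ({y | ∀ᶠ t in atTop, modelChoice α (switcher ⟨θ, π, p⟩ C)
            (history α (switcher ⟨θ, π, p⟩ C) y t) = .initial} ∪
          {y | ¬ ∀ t a ω, θ.Correct a ω → θ.q a ω (y t a) = E.q a (y t a)} ∪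
          {y | ∃ t, ENNReal.ofReal (α * b) ≤
            truthRatio C (play (θ.dogmatic π p) [] y t)}) := by
        refine measure_mono fun y hy => ?_
        by_cases h1 : ∀ t a ω, θ.Correct a ω → θ.q a ω (y t a) = E.q a (y t a)
        · by_cases h2 : ∃ t, ENNReal.ofReal (α * b) ≤
            truthRatio C (play (θ.dogmatic π p) [] y t)
          · exact Or.inr h2
          · push Not at h2
            exact Or.inl (Or.inl (Eventually.of_forall fun t =>
              (modelChoice_eq_initial hb hs h1 hy h2 t).2))
        · exact Or.inl (Or.inr h1)
    _ ≤ 0 + 0 + truthRatio C [] / ENNReal.ofReal (α * b) := by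
        refine (measure_union_le _ _).trans (add_le_add ((measure_union_le _ _).trans
          (add_le_add hzero.le ?_)) hville)
        exact (ae_iff.1 (ae_correct_eq θ)).le
    _ ≤ ENNReal.ofReal b := by
        rw [truthRatio_nil, zero_add, zero_add,
          ENNReal.div_le_iff_le_mul (Or.inl (by simpa using hαb)) (Or.inl ENNReal.ofReal_ne_top),
          ← ENNReal.ofReal_mul hb.le, ENNReal.one_le_ofReal]
        nlinarith

end Sufficiency

end ModelSwitching
end

noncomputable section
namespace ModelSwitching

variable {A Y : Type*} [MeasurableSpace Y] {E : Environment A Y}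

/-! ### Persistence against the mixture with the truth -/

section MixtureRatio

theorem mul_div_convexComb_eq {p q η : ℝ} (hm : (1 - η) * q + η * p ≠ 0) :
    p * (q / ((1 - η) * q + η * p)) = (1 - η) * p + η * q -
      η * (1 - η) * (q - p) ^ 2 / ((1 - η) * q + η * p) := by
  rw [← mul_div_assoc, eq_sub_iff_add_eq, ← add_div, div_eq_iff hm]
  ring

variable (θ : Model E) {η : ℝ} (h0 : 0 < η) (h1 : η < 1)

/-- Ratio of the density of `θ` to that of its mixture with the truth. -/
def mixRatio (ω : θ.params) (a : A) (y : Y) : ℝ := θ.q a ω y / (θ.mixTruth h0 h1).q a ω y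

theorem mixRatio_pos (ω : θ.params) (a : A) (y : Y) : 0 < mixRatio θ h0 h1 ω a y :=
  div_pos (θ.q_pos a ω y) ((θ.mixTruth h0 h1).q_pos a ω y)

theorem measurable_mixRatio (ω : θ.params) (a : A) : Measurable (mixRatio θ h0 h1 ω a) :=
  (θ.measurable_q a ω).div ((θ.mixTruth h0 h1).measurable_q a ω)

/-- True expectation of the ratio `mixRatio`. -/
def meanMixRatio (ω : θ.params) (a : A) : ℝ≥0∞ :=
  ∫⁻ y, ENNReal.ofReal (mixRatio θ h0 h1 ω a y) ∂E.law a

theorem q_mul_mixRatio_le (ω : θ.params) (a : A) (y : Y) :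
    E.q a y * mixRatio θ h0 h1 ω a y ≤ (1 - η) * E.q a y + η * θ.q a ω y := by
  have hm := (θ.mixTruth h0 h1).q_pos a ω y
  have h := mul_div_convexComb_eq (p := E.q a y) (q := θ.q a ω y) (η := η) hm.ne'
  have hnn : 0 ≤ η * (1 - η) * (θ.q a ω y - E.q a y) ^ 2 /
      ((1 - η) * θ.q a ω y + η * E.q a y) :=
    div_nonneg (mul_nonneg (mul_nonneg h0.le (sub_nonneg.2 h1.le)) (sq_nonneg _)) hm.le
  change E.q a y * (θ.q a ω y / ((1 - η) * θ.q a ω y + η * E.q a y)) ≤ _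
  linarith

theorem q_eq_of_q_mul_mixRatio_eq (ω : θ.params) (a : A) (y : Y)
    (heq : E.q a y * mixRatio θ h0 h1 ω a y = (1 - η) * E.q a y + η * θ.q a ω y) :
    θ.q a ω y = E.q a y := by
  have hm := (θ.mixTruth h0 h1).q_pos a ω y
  have h := mul_div_convexComb_eq (p := E.q a y) (q := θ.q a ω y) (η := η) hm.ne'
  change E.q a y * (θ.q a ω y / ((1 - η) * θ.q a ω y + η * E.q a y)) = _ at heq
  have hz : η * (1 - η) * (θ.q a ω y - E.q a y) ^ 2 /
      ((1 - η) * θ.q a ω y + η * E.q a y) = 0 := by linarith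
  have hη : η * (1 - η) ≠ 0 := (mul_pos h0 (sub_pos.2 h1)).ne'
  rcases div_eq_zero_iff.1 hz with hz | hz
  · exact sub_eq_zero.1 (pow_eq_zero_iff two_ne_zero |>.1 ((mul_eq_zero.1 hz).resolve_left hη))
  · exact absurd hz hm.ne'

theorem lintegral_truth_mix (θ : Model E) {η : ℝ} (h0 : 0 < η) (h1 : η < 1) (ω : θ.params) (a : A) :
    ∫⁻ y, ENNReal.ofReal ((1 - η) * E.q a y + η * θ.q a ω y) ∂E.ν = 1 := by
  have h := congrArg (fun μ : Measure Y => μ Set.univ)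
    (withDensity_convexComb E.ν (E.measurable_q a) (θ.measurable_q a ω) (E.q_pos a)
      (θ.q_pos a ω) h0 h1)
  simp only [Measure.add_apply, Measure.smul_apply, withDensity_apply _ MeasurableSet.univ,
    Measure.restrict_univ, θ.lintegral_q, E.lintegral_q, smul_eq_mul, mul_one] at h
  rw [h, ← ENNReal.ofReal_add (sub_nonneg.2 h1.le) h0.le, sub_add_cancel, ENNReal.ofReal_one]

theorem meanMixRatio_le_one (ω : θ.params) (a : A) : meanMixRatio θ h0 h1 ω a ≤ 1 := by
  rw [meanMixRatio, E.lintegral_law a (measurable_mixRatio θ h0 h1 ω a),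
    ← lintegral_truth_mix θ h0 h1 ω a]
  exact lintegral_mono fun y => ENNReal.ofReal_le_ofReal (q_mul_mixRatio_le θ h0 h1 ω a y)

theorem meanMixRatio_lt_one {ω : θ.params} {a : A} (hc : ¬ θ.Correct a ω) :
    meanMixRatio θ h0 h1 ω a < 1 := by
  refine lt_of_le_of_ne (meanMixRatio_le_one θ h0 h1 ω a) fun heq => hc ?_
  rw [meanMixRatio, E.lintegral_law a (measurable_mixRatio θ h0 h1 ω a)] at heq
  have hae := ae_eq_of_ae_le_of_lintegral_le
    (ae_of_all E.ν fun y => ENNReal.ofReal_le_ofReal (q_mul_mixRatio_le θ h0 h1 ω a y))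
    (by rw [heq]; exact ENNReal.one_ne_top)
    (((E.measurable_q a).const_mul (1 - η)).add
      ((θ.measurable_q a ω).const_mul η)).ennreal_ofReal.aemeasurable
    (by rw [heq, lintegral_truth_mix θ h0 h1])
  filter_upwards [hae] with y hy
  refine q_eq_of_q_mul_mixRatio_eq θ h0 h1 ω a y ?_
  exact (ENNReal.ofReal_eq_ofReal_iff
    (mul_pos (E.q_pos a y) (mixRatio_pos θ h0 h1 ω a y)).le
    (add_pos (mul_pos (sub_pos.2 h1) (E.q_pos a y)) (mul_pos h0 (θ.q_pos a ω y))).le).1 hy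

theorem meanMixRatio_ne_zero (ω : θ.params) (a : A) : meanMixRatio θ h0 h1 ω a ≠ 0 := by
  intro h
  have hae := (lintegral_eq_zero_iff (measurable_mixRatio θ h0 h1 ω a).ennreal_ofReal).1 h
  obtain ⟨y, hy⟩ := hae.exists
  exact (ENNReal.ofReal_pos.2 (mixRatio_pos θ h0 h1 ω a y)).ne' hy

theorem meanMixRatio_ne_top (ω : θ.params) (a : A) : meanMixRatio θ h0 h1 ω a ≠ ∞ :=
  ne_top_of_le_ne_top ENNReal.one_ne_top (meanMixRatio_le_one θ h0 h1 ω a)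

/-- The density ratio, normalized to have mean one. -/
def normMixRatio (ω : θ.params) (a : A) (y : Y) : ℝ≥0∞ :=
  ENNReal.ofReal (mixRatio θ h0 h1 ω a y) / meanMixRatio θ h0 h1 ω a

theorem measurable_normMixRatio (ω : θ.params) (a : A) :
    Measurable (normMixRatio θ h0 h1 ω a) :=
  (measurable_mixRatio θ h0 h1 ω a).ennreal_ofReal.div_const _

theorem lintegral_normMixRatio_le (ω : θ.params) (a : A) :
    ∫⁻ y, normMixRatio θ h0 h1 ω a y ∂E.law a ≤ 1 := by
  simp only [normMixRatio, div_eq_mul_inv]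
  rw [lintegral_mul_const _ (measurable_mixRatio θ h0 h1 ω a).ennreal_ofReal]
  exact ENNReal.mul_inv_le_one _

theorem ofReal_paramLikelihood_ratio (ω : θ.params) (h : List (A × Y)) :
    ENNReal.ofReal (θ.paramLikelihood ω h / (θ.mixTruth h0 h1).paramLikelihood ω h) =
      (h.map fun x => normMixRatio θ h0 h1 ω x.1 x.2).prod *
        (h.map fun x => meanMixRatio θ h0 h1 ω x.1).prod := by
  induction h with
  | nil =>
    change ENNReal.ofReal (1 / 1) = _
    simp
  | cons x h ih =>
    have hcons : θ.paramLikelihood ω (x :: h) / (θ.mixTruth h0 h1).paramLikelihood ω (x :: h) =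
        mixRatio θ h0 h1 ω x.1 x.2 *
          (θ.paramLikelihood ω h / (θ.mixTruth h0 h1).paramLikelihood ω h) := by
      rw [Model.paramLikelihood_cons]
      exact (congrArg _ ((θ.mixTruth h0 h1).paramLikelihood_cons ω x h)).trans
        (div_mul_div_comm _ _ _ _).symm
    rw [hcons, ENNReal.ofReal_mul (mixRatio_pos θ h0 h1 ω x.1 x.2).le, ih, List.map_cons, List.map_cons,
      List.prod_cons, List.prod_cons, mul_mul_mul_comm]
    congr 1
    exact (ENNReal.div_mul_cancel (meanMixRatio_ne_zero θ h0 h1 ω x.1)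
      (meanMixRatio_ne_top θ h0 h1 ω x.1)).symm

end MixtureRatio

section Concentration

theorem tendsto_zero_of_frequently_mul_le {u : ℕ → ℝ≥0∞} {k : ℝ≥0∞} (hk : k < 1)
    (hu : ∀ t, u (t + 1) ≤ u t) (hu0 : u 0 ≠ ∞) (hfreq : ∃ᶠ t in atTop, u (t + 1) ≤ k * u t) :
    Tendsto u atTop (nhds 0) := by
  have hanti : Antitone u := antitone_nat_of_succ_le hu
  have hpow : ∀ n : ℕ, ∃ T, u T ≤ k ^ n * u 0 := by
    intro n
    induction n with
    | zero => exact ⟨0, by simp⟩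
    | succ n ih =>
      obtain ⟨T, hT⟩ := ih
      obtain ⟨t, hTt, ht⟩ := frequently_atTop.1 hfreq T
      refine ⟨t + 1, ht.trans ?_⟩
      rw [pow_succ', mul_assoc]
      gcongr
      exact (hanti hTt).trans hT
  have hlim : Tendsto (fun n : ℕ => k ^ n * u 0) atTop (nhds 0) := by
    simpa using ENNReal.Tendsto.mul_const
      (ENNReal.tendsto_pow_atTop_nhds_zero_of_lt_one hk) (Or.inr hu0)
  refine ENNReal.tendsto_atTop_zero.2 fun ε hε => ?_
  obtain ⟨n, hn⟩ := (hlim.eventually (ge_mem_nhds hε)).exists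
  obtain ⟨T, hT⟩ := hpow n
  exact ⟨T, fun t ht => (hanti ht).trans (hT.trans hn)⟩

variable {θ : Model E} {η : ℝ} (h0 : 0 < η) (h1 : η < 1)

theorem tendsto_prod_meanMixRatio [Fintype A] {ω : θ.params} (σ : List (A × Y) → A) (y : ℕ → A → Y)
    (hfreq : ∃ᶠ t in atTop, ¬ θ.Correct (σ (play σ [] y t)) ω) :
    Tendsto (fun t => ((play σ [] y t).map fun x => meanMixRatio θ h0 h1 ω x.1).prod) atTop
      (nhds 0) := by
  classical
  obtain ⟨k, hk, hle⟩ : ∃ k < 1, ∀ a, ¬ θ.Correct a ω → meanMixRatio θ h0 h1 ω a ≤ k := by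
    refine ⟨(Finset.univ.filter fun a => ¬ θ.Correct a ω).sup (meanMixRatio θ h0 h1 ω),
      (Finset.sup_lt_iff (by simp)).2 fun a ha =>
        meanMixRatio_lt_one θ h0 h1 (Finset.mem_filter.1 ha).2, fun a ha =>
      Finset.le_sup (f := meanMixRatio θ h0 h1 ω) (by simpa using ha)⟩
  refine tendsto_zero_of_frequently_mul_le hk (fun t => ?_) (by simp [play])
    (hfreq.mono fun t ht => ?_)
  · rw [play, List.map_cons, List.prod_cons]
    exact mul_le_of_le_one_left' (meanMixRatio_le_one θ h0 h1 ω _)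
  · rw [play, List.map_cons, List.prod_cons]
    gcongr
    exact hle _ ht

theorem posterior_le_of_no_switch {α : ℝ} {π : θ.Belief} (ω : θ.params)
    {h : List (A × Y)} (hα : (θ.mixTruth h0 h1).likelihood π h ≤ α * θ.likelihood π h) :
    (θ.posterior π h).1 ω ≤
      α * (θ.paramLikelihood ω h / (θ.mixTruth h0 h1).paramLikelihood ω h) := by
  have hl := θ.paramLikelihood_pos ω h
  have hc : 0 < (θ.mixTruth h0 h1).paramLikelihood ω h :=
    (θ.mixTruth h0 h1).paramLikelihood_pos ω h
  have hL := θ.likelihood_pos π h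
  have hle : π.1 ω * (θ.mixTruth h0 h1).paramLikelihood ω h ≤
      (θ.mixTruth h0 h1).likelihood π h :=
    (Finset.sum_singleton (fun ω : θ.params => π.1 ω * (θ.mixTruth h0 h1).paramLikelihood ω h)
      ω).symm.trans_le ((θ.mixTruth h0 h1).sum_mul_paramLikelihood_le π {ω} h)
  rw [Model.posterior_apply, ← mul_div_assoc, div_le_div_iff₀ hL hc]
  calc π.1 ω * θ.paramLikelihood ω h * (θ.mixTruth h0 h1).paramLikelihood ω h
      = (π.1 ω * (θ.mixTruth h0 h1).paramLikelihood ω h) * θ.paramLikelihood ω h := by ring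
    _ ≤ (α * θ.likelihood π h) * θ.paramLikelihood ω h :=
        mul_le_mul_of_nonneg_right (hle.trans hα) hl.le
    _ = α * θ.paramLikelihood ω h * θ.likelihood π h := by ring

theorem likelihood_le_of_modelChoice {α : ℝ} {I C : Endowed E} {x : A × Y} {h : List (A × Y)}
    (hm : modelChoice α (switcher I C) h = .initial)
    (hm' : modelChoice α (switcher I C) (x :: h) = .initial) :
    C.likelihood (x :: h) ≤ α * I.likelihood (x :: h) := by
  by_contra! hlt
  have hpos : 0 < I.likelihood (x :: h) := I.model.likelihood_pos I.prior _
  have hcond : α < C.likelihood (x :: h) / I.likelihood (x :: h) := (lt_div_iff₀ hpos).2 hlt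
  have hstep : modelChoice α (switcher I C) (x :: h) =
      if α < (switcher I C (modelChoice α (switcher I C) h).other).likelihood (x :: h) /
          (switcher I C (modelChoice α (switcher I C) h)).likelihood (x :: h)
        then (modelChoice α (switcher I C) h).other else modelChoice α (switcher I C) h := rfl
  rw [hm] at hstep
  have : modelChoice α (switcher I C) (x :: h) = .competing := hstep.trans (if_pos hcond)
  rw [this] at hm'
  cases hm'

/-- Along a path on which `θ` is eventually kept, a parameter that mispredicts the outcomes of
infinitely many actions is eventually discarded. -/
theorem tendsto_posterior_zero [Fintype A] {α : ℝ} {π : θ.Belief} (p : θ.Belief → A)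
    (p' : (θ.mixTruth h0 h1).Belief → A) {S : Role → Endowed E}
    (hS : S = switcher ⟨θ, π, p⟩ ⟨θ.mixTruth h0 h1, π, p'⟩) {y : ℕ → A → Y}
    (hm : ∀ᶠ t in atTop, modelChoice α S (play (action α S) [] y t) = .initial) {ω : θ.params}
    {B : ℝ≥0∞} (hB : B ≠ ∞)
    (hbound : ∀ t, ((play (action α S) [] y t).map
      fun x => normMixRatio θ h0 h1 ω x.1 x.2).prod ≤ B)
    (hfreq : ∃ᶠ t in atTop, ¬ θ.Correct (action α S (play (action α S) [] y t)) ω) :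
    Tendsto (fun t => (θ.posterior π (play (action α S) [] y t)).1 ω) atTop (nhds 0) := by
  set R : ℕ → ℝ := fun t => θ.paramLikelihood ω (play (action α S) [] y t) /
    (θ.mixTruth h0 h1).paramLikelihood ω (play (action α S) [] y t)
  have hRpos : ∀ t, 0 ≤ R t := fun t => (div_pos (θ.paramLikelihood_pos ω _)
    ((θ.mixTruth h0 h1).paramLikelihood_pos ω _)).le
  have hR : Tendsto R atTop (nhds 0) := by
    have hE : Tendsto (fun t => ENNReal.ofReal (R t)) atTop (nhds 0) := by
      have hlim := ENNReal.Tendsto.const_mul (a := B)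
        (tendsto_prod_meanMixRatio h0 h1 (action α S) y hfreq) (Or.inr hB)
      rw [mul_zero] at hlim
      refine tendsto_of_tendsto_of_tendsto_of_le_of_le tendsto_const_nhds hlim
        (fun _ => zero_le) fun t => ?_
      simp only [R]
      rw [ofReal_paramLikelihood_ratio θ h0 h1 ω]
      gcongr
      exact hbound t
    have := (ENNReal.tendsto_toReal ENNReal.zero_ne_top).comp hE
    exact this.congr fun t => ENNReal.toReal_ofReal (hRpos t)
  have hlim : Tendsto (fun t => α * R t) atTop (nhds 0) := by simpa using hR.const_mul α
  rw [← tendsto_add_atTop_iff_nat 1] at hlim ⊢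
  refine tendsto_of_tendsto_of_tendsto_of_le_of_le' tendsto_const_nhds hlim
    (Eventually.of_forall fun t => (θ.posterior π _).2.1 ω) ?_
  filter_upwards [hm, (tendsto_add_atTop_nat 1).eventually hm] with t ht ht'
  refine posterior_le_of_no_switch h0 h1 ω ?_
  subst hS
  exact likelihood_le_of_modelChoice ht ht'

/-- Persistence against the mixture with the truth makes the dogmatic play of `θ`, from the
posterior after a suitable history, stay with high probability among the actions whose outcomes are
correctly predicted by a set of parameters of high weight. -/
theorem exists_absorbing_of_persists [Fintype A] {α : ℝ} {π : θ.Belief}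
    {p : θ.Belief → A} (hp : ∀ a, MeasurableSet (p ⁻¹' {a}))
    {p' : (θ.mixTruth h0 h1).Belief → A} (hp' : ∀ a, MeasurableSet (p' ⁻¹' {a}))
    (hpers : Persists α ⟨θ, π, p⟩ ⟨θ.mixTruth h0 h1, π, p'⟩) {b : ℝ} (hb : b < 1) :
    ∃ (h : List (A × Y)) (s : Finset θ.params), b < ∑ ω ∈ s, (θ.posterior π h).1 ω ∧
      ENNReal.ofReal b < outcomeLaw E {y | ∀ t, ∀ ω ∈ s, θ.Correct
        (θ.dogmatic (θ.posterior π h) p (play (θ.dogmatic (θ.posterior π h) p) [] y t)) ω} := by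
  classical
  let _ : MeasurableSpace A := ⊤
  have : DiscreteMeasurableSpace A := ⟨fun _ => trivial⟩
  obtain ⟨S, hS⟩ : ∃ S, S = switcher ⟨θ, π, p⟩ ⟨θ.mixTruth h0 h1, π, p'⟩ := ⟨_, rfl⟩
  have hSp : ∀ r a, MeasurableSet ((S r).policy ⁻¹' {a}) := by
    subst hS
    rintro (_ | _) a
    · exact hp a
    · exact hp' a
  have hσ : ListMeasurable (action α S) := listMeasurable_action α S hSp
  set σ := action α S with hσdef
  have hbound : ∀ᵐ y ∂outcomeLaw E, ∃ B : ℕ, ∀ t,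
      ∑ ω : θ.params, (1 : ℝ≥0∞) * ((play σ [] y t).map
        fun x => normMixRatio θ h0 h1 ω x.1 x.2).prod < B := by
    refine ae_exists_play_lt hσ (listMeasurable_sum_prod (fun _ => 1)
      fun ω a => measurable_normMixRatio θ h0 h1 ω a) (fun h a => lintegral_sum_prod_le (fun _ => 1)
        (fun ω a => measurable_normMixRatio θ h0 h1 ω a)
        (fun ω a => lintegral_normMixRatio_le θ h0 h1 ω a) h a) ?_
    simp
  set G : Finset θ.params × ℕ → Set (ℕ → A → Y) := fun c => {y | ∀ t, c.2 ≤ t →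
    modelChoice α S (play σ [] y t) = .initial ∧ (∀ ω ∈ c.1, θ.Correct (σ (play σ [] y t)) ω) ∧
      b < ∑ ω ∈ c.1, (θ.posterior π (play σ [] y t)).1 ω} with hGdef
  have hcover : {y | ∀ᶠ t in atTop, modelChoice α S (play σ [] y t) = .initial} ≤ᵐ[outcomeLaw E]
      ⋃ c, G c := by
    filter_upwards [hbound] with y hy hm
    obtain ⟨B, hB⟩ := hy
    refine Set.mem_iUnion.2 ?_
    set s : Finset θ.params :=
      Finset.univ.filter fun ω => ∀ᶠ t in atTop, θ.Correct (σ (play σ [] y t)) ω with hs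
    have hout : ∀ ω ∉ s,
        Tendsto (fun t => (θ.posterior π (play σ [] y t)).1 ω) atTop (nhds 0) := by
      intro ω hω
      refine tendsto_posterior_zero h0 h1 p p' hS hm (B := B) (ENNReal.natCast_ne_top B)
        (fun t => ?_) (fun hev => hω ?_)
      swap
      · exact Finset.mem_filter.2 ⟨Finset.mem_univ ω, by simpa using hev⟩
      · refine le_trans ?_ (hB t).le
        have := Finset.single_le_sum (f := fun ω : θ.params => (1 : ℝ≥0∞) * ((play σ [] y t).map
          fun x => normMixRatio θ h0 h1 ω x.1 x.2).prod) (fun _ _ => zero_le)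
          (Finset.mem_univ ω)
        simpa using this
    have hsum : Tendsto (fun t => ∑ ω ∈ s, (θ.posterior π (play σ [] y t)).1 ω) atTop
        (nhds 1) := by
      have hz : Tendsto (fun t => ∑ ω ∈ sᶜ, (θ.posterior π (play σ [] y t)).1 ω) atTop
          (nhds 0) := by
        simpa using tendsto_finsetSum sᶜ fun ω hω => hout ω (Finset.mem_compl.1 hω)
      have := hz.const_sub 1
      rw [sub_zero] at this
      refine this.congr fun t => ?_
      have htot : ∑ ω, (θ.posterior π (play σ [] y t)).1 ω = 1 := (θ.posterior π _).2.2
      rw [← htot, ← Finset.sum_add_sum_compl s, add_sub_cancel_right]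
    have hcorr : ∀ᶠ t in atTop, ∀ ω ∈ s, θ.Correct (σ (play σ [] y t)) ω :=
      (Finset.eventually_all s).2 fun ω hω => (Finset.mem_filter.1 hω).2
    obtain ⟨T, hT⟩ := eventually_atTop.1
      (hm.and (hcorr.and (hsum.eventually (lt_mem_nhds hb))))
    exact ⟨(s, T), fun t ht => hT t ht⟩
  have hpers' : outcomeLaw E {y | ∀ᶠ t in atTop,
      modelChoice α S (play σ [] y t) = .initial} ≠ 0 := by
    have := hpers.ne'
    rw [← hS] at this
    simpa only [history_eq_play, ← hσdef] using this
  obtain ⟨⟨s, T⟩, hc⟩ : ∃ c, outcomeLaw E (G c) ≠ 0 := by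
    by_contra! hall
    exact hpers' (le_antisymm ((measure_mono_ae hcover).trans
      (measure_iUnion_null hall).le) zero_le)
  have hGm : MeasurableSet (G (s, T)) := by
    have hGe : G (s, T) = ⋂ t, ⋂ _ : T ≤ t,
        ({y | modelChoice α S (play σ [] y t) ∈ ({.initial} : Set Role)} ∩
        ({y | σ (play σ [] y t) ∈ {a | ∀ ω ∈ s, θ.Correct a ω}} ∩
        {y | b < ∑ ω ∈ s, (θ.posterior π (play σ [] y t)).1 ω})) := by
      ext y
      simp only [hGdef, Set.mem_iInter]
      rfl
    rw [hGe]
    refine MeasurableSet.iInter fun t => MeasurableSet.iInter fun _ => ?_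
    refine ((listMeasurable_modelChoice α S).play hσ [] t (MeasurableSet.of_discrete)).inter
      ((hσ.play hσ [] t (MeasurableSet.of_discrete)).inter
        (measurableSet_lt measurable_const ?_))
    refine Finset.measurable_sum _ fun ω _ => ?_
    exact (measurable_pi_apply ω).comp
      (measurable_subtype_coe.comp ((θ.listMeasurable_posterior π).play hσ [] t))
  obtain ⟨n, hTn, x, hx⟩ := exists_past_lt_measure (Measure.pi fun a => E.law a) hGm hc
    (ENNReal.ofReal_lt_one.2 hb) T
  set h := play σ [] x n with hh
  have hz : ∀ z, splice n (x, z) ∈ G (s, T) → ∀ t,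
      modelChoice α S (play σ h z t) = .initial ∧
        (∀ ω ∈ s, θ.Correct (σ (play σ h z t)) ω) ∧
        b < ∑ ω ∈ s, (θ.posterior π (play σ h z t)).1 ω := by
    intro z hz t
    have := hz (n + t) (hTn.trans (Nat.le_add_right n t))
    rwa [play_splice] at this
  have hdog : ∀ l, modelChoice α S (l ++ h) = .initial →
      σ (l ++ h) = θ.dogmatic (θ.posterior π h) p l := by
    intro l hl
    rw [hσdef, action, hl, hS, Model.dogmatic, ← Model.posterior_append]
    rfl
  refine ⟨h, s, ?_, hx.trans_le (measure_mono fun z hzG t => ?_)⟩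
  · obtain ⟨z, hzG⟩ := nonempty_of_measure_ne_zero (pos_of_gt hx).ne'
    exact (hz z hzG 0).2.2
  · have hplay : ∀ t,
        play σ h z t = play (θ.dogmatic (θ.posterior π h) p) [] z t ++ h := by
      intro t
      induction t with
      | zero => rfl
      | succ t ih =>
        have hm := (hz z hzG t).1
        rw [ih] at hm
        rw [play, play, ih, hdog _ hm, List.cons_append]
    have hmt := hz z hzG t
    rw [hplay] at hmt
    rw [← hdog _ hmt.1]
    exact hmt.2.1

end Concentration

end ModelSwitching
end

theorem theorem3 (d : ℕ) (𝒴 : Set (EuclideanSpace ℝ (Fin d)))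
    (h𝒴 : 𝒴 = Set.univ ∨ IsCompact 𝒴) {A : Type*} [Fintype A] [Nonempty A]
    (E : ModelSwitching.Environment A 𝒴) (δ α : ℝ) (hδ0 : 0 ≤ δ) (hδ1 : δ < 1) (hα : 1 < α)
    (θ : ModelSwitching.Model E) :
    ModelSwitching.UnconstrainedLocallyRobust δ α θ ↔ ModelSwitching.GloballyRobust δ α θ := by
  constructor
  · rintro ⟨ε, hε, π, p, hπ, hp, hpers⟩
    have h0 : 0 < min ε (1 / 2) := lt_min hε (by norm_num)
    have h1 : min ε (1 / 2) < 1 := (min_le_right _ _).trans_lt (by norm_num)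
    obtain ⟨p', hp'⟩ := (θ.mixTruth h0 h1).exists_isOptimalPolicy hδ0 hδ1
    have hmix := hpers (θ.mixTruth h0 h1)
      (θ.neighborhood_mono (min_le_left _ _) (θ.mixTruth_mem_neighborhood h0 h1)) π
      (θ.nearbyBeliefs_mono _ π (min_le_left _ _) (θ.mem_nearbyBeliefs_mixTruth h0 h1 π)) p' hπ hp'
    obtain ⟨b, hb0, hb1, hαb⟩ : ∃ b : ℝ, 0 < b ∧ b < 1 ∧ 1 ≤ α * b ^ 2 := by
      have hα0 : 0 < α := zero_lt_one.trans hα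
      refine ⟨Real.sqrt α⁻¹, Real.sqrt_pos.2 (inv_pos.2 hα0), ?_, ?_⟩
      · rw [Real.sqrt_lt' one_pos, one_pow]
        exact inv_lt_one_of_one_lt₀ hα
      · rw [Real.sq_sqrt (inv_pos.2 hα0).le, mul_inv_cancel₀ hα0.ne']
    obtain ⟨h, s, hs, hprob⟩ := ModelSwitching.exists_absorbing_of_persists h0 h1
      hp.measurable hp'.measurable hmix hb1
    exact ⟨θ.posterior π h, p, hπ.posterior h, hp, fun θ' π' p' _ _ =>
      ModelSwitching.persists_of_absorbing hp.measurable hb0 hαb hs hprob _⟩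
  · rintro ⟨π, p, hπ, hp, hpers⟩
    exact ⟨1, one_pos, π, p, hπ, hp, fun θ' _ π' _ p' hπ' hp' => hpers θ' π' p' hπ' hp'⟩
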